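/- Let $n\ge 2$ and let $\Sigma=\{\pm(e_i+e_j),\pm(e_i-e_j),\pm e_i \mid i\ne j\}\subset\mathbb R^n$ be the root system of type $B_n$, with simple roots $\Theta=\{\alpha_1=e_1-e_2,\dots,\alpha_{n-1}=e_{n-1}-e_n,\alpha_n=e_n\}$, set $\Sigma^+$ of positive roots, and Weyl group $W$ with length function $\ell$ and Bruhat order $\le$. Write $s_\alpha$ for the reflection in the root $\alpha$. Let $\Theta_P,\Theta_Q\subseteq\Theta$ be arbitrary subsets, and let $W_P,W_Q\subseteq W$ be the subgroups generated by the corresponding simple reflections. Let $W^P$ and ${}^QW^P$ be the sets of minimal length representatives of $W/W_P$ and of $W_Q\backslash W/W_P$, and for $w\in W$ let $\overline w\in W^P$ and $\widehat w\in{}^QW^P$ be the representatives of $wW_P$ and of $W_QwW_P$. The parabolic moment graph $\mathcal G^P$ has vertex set $W^P$ and the edges $w\to\overline{s_\alpha w}$ labelled by $\alpha$, for all $w\in W^P$ and $\alpha\in\Sigma^+$ with $w\le s_\alpha w$ and $\overline{w}\ne\overline{s_\alpha w}$. A double moment graph ${}^Q\mathcal G^P$ has vertex set ${}^QW^P$ and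 an edge $u\to u'$ for all $u\neq u'$ in ${}^QW^P$ such that $u'=\widehat{s_\beta u}$ and $u\le s_\beta u$ for some $\beta\in\Sigma^+$, together with a choice, for each edge $u\to u'$, of one such root $\beta$ as its label $l(u\to u')$. It is viewed as the subgraph $\mathcal G'$ of $\mathcal G^P$ whose vertices are all $u\in{}^QW^P$ and all $\overline{s_{l(u\to u')}u}$, and whose edges are $u\to\overline{s_{l(u\to u')}u}$ with label $l(u\to u')$, for all edges $u\to u'$ of ${}^Q\mathcal G^P$. Let $w\in W_Q$ act on $W^P$ by $w(x)=\overline{wx}$. The closure $\langle{}^Q\mathcal G^P\rangle$ is the graph whose vertices are all $w(x)$, for $w\in W_Q$ and $x$ a vertex of $\mathcal G'$, and whose edges are: all edges of $\mathcal G^P$ of the form $w(x)\to v(x)$ with $v,w\in W_Q$ and $x$ a vertex of $\mathcal G'$; and, for each edge $x\to y$ of $\mathcal G'$ with label $\alpha$ and each $w\in W_Q$, the edge $w(x)\to w(y)$ with label $w(\alpha)$ if $w(\alpha)\in\Sigma^+$, and the edge $w(y)\to w(x)$ with label $-w(\alpha)$ if $-w(\alpha)\in\Sigma^+$. The double moment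 graph is called closed if $\langle{}^Q\mathcal G^P\rangle=\mathcal G^P$. Then a double moment graph ${}^Q\mathcal G^P$ (with any choice of labels) is closed if and only if at least one of the following holds: 1. there are $p,q\in\{1,\dots,n\}$ such that $\Theta_P=\{\alpha_p,\dots,\alpha_n\}$ and $\Theta_Q=\{\alpha_q,\dots,\alpha_n\}$; 2. $\alpha_n\notin\Theta_P$ and $\alpha_n\notin\Theta_Q$; 3. $\Theta_P=\Theta$ or $\Theta_Q=\Theta$; 4. $\Theta_P=\emptyset$ or $\Theta_Q=\emptyset$. -/

import Mathlib

/-!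
Parabolic and double moment graphs of a root system `Φ` with set of simple roots `Θ`, realized in
a Euclidean space `V`, and the root system of type `B`. Elements of Weyl groups are
linear isometries of `V`.
-/

noncomputable section

namespace DoubleMoment

section General

variable {V : Type*} [NormedAddCommGroup V] [InnerProductSpace ℝ V]

/-- The reflection `s_α` in the hyperplane orthogonal to `α`. -/
def refl (α : V) : V ≃ₗᵢ[ℝ] V := Submodule.reflection (Submodule.span ℝ {α})ᗮ

/-- The group generated by the reflections in the elements of `S`. For `S = Θ` this is the Weyl
group `W`, for `S = Θ_P` and `S = Θ_Q` it is `W_P` and `W_Q`. -/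
def weyl (S : Set V) : Subgroup (V ≃ₗᵢ[ℝ] V) := Subgroup.closure (refl '' S)

/-- The positive roots: the roots that are sums of simple roots (with repetitions). -/
def posRoots (Φ Θ : Set V) : Set V := {β | β ∈ Φ ∧ β ∈ AddSubmonoid.closure Θ}

/-- The length of `w ∈ W`: the least number of factors in an expression of `w` as
a product of simple reflections. -/
def length (Θ : Set V) (w : V ≃ₗᵢ[ℝ] V) : ℕ :=
  sInf {k | ∃ l : List V, l.length = k ∧ (∀ α ∈ l, α ∈ Θ) ∧ (l.map refl).prod = w}

/-- The Bruhat order on `W`: the reflexive and transitive closure of the relations `x < s_β x`, for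
`β` a positive root with `ℓ(x) < ℓ(s_β x)`. -/
def bruhatLE (Φ Θ : Set V) : (V ≃ₗᵢ[ℝ] V) → (V ≃ₗᵢ[ℝ] V) → Prop :=
  Relation.ReflTransGen fun x y =>
    ∃ β ∈ posRoots Φ Θ, y = refl β * x ∧ length Θ x < length Θ y

/-- The double coset `W_Q w W_P`. -/
def doubleCoset (ΘQ ΘP : Set V) (w : V ≃ₗᵢ[ℝ] V) : Set (V ≃ₗᵢ[ℝ] V) :=
  {x | ∃ a ∈ weyl ΘQ, ∃ b ∈ weyl ΘP, x = a * w * b}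

theorem doubleCoset_nonempty (ΘQ ΘP : Set V) (w : V ≃ₗᵢ[ℝ] V) :
    (doubleCoset ΘQ ΘP w).Nonempty :=
  ⟨w, 1, one_mem _, 1, one_mem _, by simp⟩

/-- The representative `ŵ` of minimal length of the double coset `W_Q w W_P`. -/
def hat (Θ ΘQ ΘP : Set V) (w : V ≃ₗᵢ[ℝ] V) : V ≃ₗᵢ[ℝ] V :=
  Function.argminOn (length Θ) (doubleCoset ΘQ ΘP w) (doubleCoset_nonempty ΘQ ΘP w)

/-- The representative `w̄` of minimal length of the left coset `w W_P`
(the case `Θ_Q = ∅`, in which `W_Q` is trivial). -/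
def bar (Θ ΘP : Set V) (w : V ≃ₗᵢ[ℝ] V) : V ≃ₗᵢ[ℝ] V := hat Θ ∅ ΘP w

/-- The set `^QW^P` of representatives of minimal length of `W_Q \ W / W_P`. -/
def doubleReps (Θ ΘQ ΘP : Set V) : Set (V ≃ₗᵢ[ℝ] V) :=
  {x | x ∈ weyl Θ ∧ ∀ y ∈ doubleCoset ΘQ ΘP x, length Θ x ≤ length Θ y}

/-- The set `W^P` of representatives of minimal length of `W / W_P`. -/
def leftReps (Θ ΘP : Set V) : Set (V ≃ₗᵢ[ℝ] V) := doubleReps Θ ∅ ΘP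

/-- A directed graph with labelled edges, on a set of elements of `W`: `edge x y α` says that there
is an edge `x → y` with label `α`. The order on the vertices is always the one induced by the Bruhat
order, so that two such graphs are equal as moment graphs iff they have the same vertices and the
same labelled edges. -/
@[ext]
structure LabelledGraph (V : Type*) [NormedAddCommGroup V] [InnerProductSpace ℝ V] where
  verts : Set (V ≃ₗᵢ[ℝ] V)
  edge : (V ≃ₗᵢ[ℝ] V) → (V ≃ₗᵢ[ℝ] V) → V → Prop

/-- The parabolic moment graph `𝒢^P`: its vertices are the elements of `W^P`, and its edges are
`w → \overline{s_α w}` with label `α`, for `w ≤ s_α w`, `w̄ ≠ \overline{s_α w}`, `α ∈ Σ⁺`. -/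
def parabolicGraph (Φ Θ ΘP : Set V) : LabelledGraph V where
  verts := leftReps Θ ΘP
  edge x y α :=
    x ∈ leftReps Θ ΘP ∧ α ∈ posRoots Φ Θ ∧ bruhatLE Φ Θ x (refl α * x) ∧
      bar Θ ΘP x ≠ bar Θ ΘP (refl α * x) ∧ y = bar Θ ΘP (refl α * x)

/-- The `H`-closure of a subgraph `𝒢'` of `𝒢`, where `w ∈ H` acts on vertices by
`x ↦ \overline{w x}`. -/
def hClosure (Φ Θ ΘP : Set V) (H : Subgroup (V ≃ₗᵢ[ℝ] V)) (𝒢 𝒢' : LabelledGraph V) :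
    LabelledGraph V where
  verts := {y | ∃ w ∈ H, ∃ x ∈ 𝒢'.verts, y = bar Θ ΘP (w * x)}
  edge y z γ :=
    (𝒢.edge y z γ ∧
      ∃ x ∈ 𝒢'.verts, ∃ w ∈ H, ∃ v ∈ H, y = bar Θ ΘP (w * x) ∧ z = bar Θ ΘP (v * x)) ∨
    (∃ a b α, 𝒢'.edge a b α ∧ ∃ w ∈ H, w α ∈ posRoots Φ Θ ∧
      y = bar Θ ΘP (w * a) ∧ z = bar Θ ΘP (w * b) ∧ γ = w α) ∨
    (∃ a b α, 𝒢'.edge a b α ∧ ∃ w ∈ H, -(w α) ∈ posRoots Φ Θ ∧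
      y = bar Θ ΘP (w * b) ∧ z = bar Θ ΘP (w * a) ∧ γ = -(w α))

/-- The positive roots that may label an edge `u → u'` of the double moment graph. -/
def admissibleLabels (Φ Θ ΘQ ΘP : Set V) (u u' : V ≃ₗᵢ[ℝ] V) : Set V :=
  {β | β ∈ posRoots Φ Θ ∧ u' = hat Θ ΘQ ΘP (refl β * u) ∧ bruhatLE Φ Θ u (refl β * u)}

/-- The edges `^QE^P` of the double moment graph on `^QW^P`. -/
def doubleEdge (Φ Θ ΘQ ΘP : Set V) (u u' : V ≃ₗᵢ[ℝ] V) : Prop :=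
  u ∈ doubleReps Θ ΘQ ΘP ∧ (∃ β, β ∈ admissibleLabels Φ Θ ΘQ ΘP u u') ∧ u ≠ u'

/-- A double moment graph `^Q𝒢^P`. Vertices `^QW^P` and edges `^QE^P` are determined by `Θ_P` and
`Θ_Q`, so the datum is the choice of one label for each edge
(the value of `label` at pairs that are not edges is irrelevant and never used). -/
structure DoubleMomentGraph (Φ Θ ΘQ ΘP : Set V) where
  label : (V ≃ₗᵢ[ℝ] V) → (V ≃ₗᵢ[ℝ] V) → V
  label_mem : ∀ u u', doubleEdge Φ Θ ΘQ ΘP u u' → label u u' ∈ admissibleLabels Φ Θ ΘQ ΘP u u'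

instance (Φ Θ ΘQ ΘP : Set V) : Nonempty (DoubleMomentGraph Φ Θ ΘQ ΘP) := by
  classical
  exact ⟨⟨fun u u' => if h : doubleEdge Φ Θ ΘQ ΘP u u' then h.2.1.choose else 0,
    fun u u' h => by simpa [h] using h.2.1.choose_spec⟩⟩

namespace DoubleMomentGraph

variable {Φ Θ ΘQ ΘP : Set V}

/-- The double moment graph viewed as a subgraph of `𝒢^P`: its vertices are all `u ∈ ^QW^P` and
all `\overline{s_{l(u → u')} u}`, and its edges are `u → \overline{s_{l(u → u')} u}`, with label
`l(u → u')`, for `u → u'` in `^QE^P`. -/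
def toSubgraph (𝒟 : DoubleMomentGraph Φ Θ ΘQ ΘP) : LabelledGraph V where
  verts := doubleReps Θ ΘQ ΘP ∪
    {x | ∃ u u', doubleEdge Φ Θ ΘQ ΘP u u' ∧ x = bar Θ ΘP (refl (𝒟.label u u') * u)}
  edge x y α := ∃ u', doubleEdge Φ Θ ΘQ ΘP x u' ∧ α = 𝒟.label x u' ∧ y = bar Θ ΘP (refl α * x)

/-- The closure `⟨^Q𝒢^P⟩`: the `W_Q`-closure in `𝒢^P`. -/
def closure (𝒟 : DoubleMomentGraph Φ Θ ΘQ ΘP) : LabelledGraph V :=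
  hClosure Φ Θ ΘP (weyl ΘQ) (parabolicGraph Φ Θ ΘP) 𝒟.toSubgraph

/-- A double moment graph is closed if `⟨^Q𝒢^P⟩ = 𝒢^P`. -/
def IsClosed (𝒟 : DoubleMomentGraph Φ Θ ΘQ ΘP) : Prop :=
  𝒟.closure = parabolicGraph Φ Θ ΘP

end DoubleMomentGraph

end General

namespace TypeB

/-- The standard basis vector `e_i` of `ℝⁿ`. -/
def e {n : ℕ} (i : Fin n) : EuclideanSpace ℝ (Fin n) := EuclideanSpace.single i 1

/-- The root system of type `B_n`. -/
def roots (n : ℕ) : Set (EuclideanSpace ℝ (Fin n)) :=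
  {β | (∃ i j, i ≠ j ∧ (β = e i + e j ∨ β = -(e i + e j) ∨ β = e i - e j ∨ β = -(e i - e j))) ∨
    ∃ i, β = e i ∨ β = -e i}

/-- The simple roots `e_i - e_{i+1}` for `i < n` and `e_n` for `i = n`; the
indices here run from `0` to `n - 1`. -/
def simpleRoot {n : ℕ} (i : Fin n) : EuclideanSpace ℝ (Fin n) :=
  if h : (i : ℕ) + 1 < n then e i - e ⟨i + 1, h⟩ else e i

/-- The set `Θ` of simple roots. -/
def simpleRoots (n : ℕ) : Set (EuclideanSpace ℝ (Fin n)) := Set.range simpleRoot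

end TypeB

end DoubleMoment

end

/-!
Let `v` and `u` be dominant vectors with stabilizers `W_P` and `W_Q`. The vertices of the parabolic
moment graph are then the points of the orbit `W v`, its edges are the reflections moving such a
point, and the double moment graph is closed if and only if the following holds: if two edges leave
the same point `x` and their other ends are equivalent under the stabilizer of `u`, then their
labels are conjugate under the common stabilizer of `u` and `x`. This condition is symmetric in `u`
and `v`.

In type `B` the orbit of a pair `(u, x)` under `W` is determined by the multiset of pairs
`(⟪u, ε⟫, ⟪x, ε⟫)`, where `ε` runs over the short roots, and reflecting `x` in a root changes only
the pairs of the short roots which it moves. The root is recovered from this change up to conjugacy,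
except when one of the two vectors is orthogonal to a short root while the other one takes the same
nonzero value on two short roots: then a short and a long root can have the same effect.
-/

namespace DoubleMoment

open scoped RealInnerProductSpace

section General

variable {V : Type*} [NormedAddCommGroup V] [InnerProductSpace ℝ V]

theorem mul_apply (g h : V ≃ₗᵢ[ℝ] V) (v : V) : (g * h) v = g (h v) := rfl

theorem inv_apply_apply (g : V ≃ₗᵢ[ℝ] V) (v : V) : g⁻¹ (g v) = v := g.symm_apply_apply v

theorem apply_inv_apply (g : V ≃ₗᵢ[ℝ] V) (v : V) : g (g⁻¹ v) = v := g.apply_symm_apply v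

theorem inv_apply_eq_iff {g : V ≃ₗᵢ[ℝ] V} {v w : V} : g⁻¹ v = w ↔ v = g w :=
  g.toEquiv.symm_apply_eq

theorem inner_inv_apply_left (g : V ≃ₗᵢ[ℝ] V) (v w : V) : ⟪g⁻¹ v, w⟫ = ⟪v, g w⟫ := by
  rw [← g.inner_map_map, apply_inv_apply]

theorem inner_apply_left (g : V ≃ₗᵢ[ℝ] V) (v w : V) : ⟪g v, w⟫ = ⟪v, g⁻¹ w⟫ := by
  rw [← inner_inv_apply_left, inv_inv]

theorem inner_apply_of_apply_eq {g : V ≃ₗᵢ[ℝ] V} {u : V} (h : g u = u) (v : V) :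
    ⟪u, g v⟫ = ⟪u, v⟫ := by
  rw [← g.inner_map_map u v, h]

/-! ### Reflections -/

theorem refl_apply (α v : V) : refl α v = v - (2 * (⟪α, v⟫ / ‖α‖ ^ 2)) • α := by
  rw [refl, Submodule.reflection_orthogonal_apply, Submodule.reflection_singleton_apply]
  simp only [RCLike.ofReal_real_eq_id, id_eq, neg_sub, two_smul, two_mul, add_smul]

theorem refl_self (α : V) : refl α α = -α :=
  Submodule.reflection_orthogonalComplement_singleton_eq_neg α

theorem refl_refl (α v : V) : refl α (refl α v) = v := Submodule.reflection_reflection _ v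

@[simp] theorem refl_mul_self (α : V) : refl α * refl α = 1 := Submodule.reflection_mul_reflection _

@[simp] theorem refl_inv (α : V) : (refl α)⁻¹ = refl α := Submodule.reflection_inv

theorem refl_mul_refl_mul (α : V) (w : V ≃ₗᵢ[ℝ] V) : refl α * (refl α * w) = w := by
  rw [← mul_assoc, refl_mul_self, one_mul]

@[simp] theorem refl_neg (α : V) : refl (-α) = refl α := by
  ext v
  simp [refl_apply, neg_div, sub_eq_add_neg]

@[simp] theorem refl_zero : refl (0 : V) = 1 := by
  ext v
  simp [refl_apply]

theorem refl_map (w : V ≃ₗᵢ[ℝ] V) (α : V) : refl (w α) = w * refl α * w⁻¹ := by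
  ext v
  simp only [mul_apply, refl_apply, map_sub, map_smul, apply_inv_apply,
    LinearIsometryEquiv.norm_map]
  rw [inner_apply_left]

theorem refl_apply_apply (w : V ≃ₗᵢ[ℝ] V) (α v : V) : refl (w α) (w v) = w (refl α v) := by
  rw [refl_map, mul_apply, mul_apply, inv_apply_apply]

theorem refl_apply_eq_self_iff {α v : V} : refl α v = v ↔ ⟪v, α⟫ = 0 := by
  rw [refl, Submodule.reflection_eq_self_iff, Submodule.mem_orthogonal_singleton_iff_inner_left]

theorem inner_refl_eq_iff {α u v : V} : ⟪u, refl α v⟫ = ⟪u, v⟫ ↔ ⟪u, α⟫ = 0 ∨ ⟪v, α⟫ = 0 := by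
  rw [refl_apply, inner_sub_right, inner_smul_right, sub_eq_self, real_inner_comm]
  rcases eq_or_ne α 0 with rfl | hα
  · simp
  · simp [hα, or_comm]

/-! ### Groups generated by reflections -/

theorem refl_mem_weyl_of_mem {S : Set V} {α : V} (h : α ∈ S) : refl α ∈ weyl S :=
  Subgroup.subset_closure ⟨α, h, rfl⟩

theorem weyl_mono {S T : Set V} (h : S ⊆ T) : weyl S ≤ weyl T :=
  Subgroup.closure_mono (Set.image_mono h)

theorem weyl_empty : weyl (∅ : Set V) = ⊥ := by simp [weyl]

theorem weyl_induction {S : Set V} {p : (w : V ≃ₗᵢ[ℝ] V) → w ∈ weyl S → Prop}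
    (one : p 1 (one_mem _))
    (refl_mul : ∀ a, ∀ ha : a ∈ S, ∀ w, ∀ hw : w ∈ weyl S, p w hw →
      p (refl a * w) (mul_mem (refl_mem_weyl_of_mem ha) hw)) {w : V ≃ₗᵢ[ℝ] V} (hw : w ∈ weyl S) :
    p w hw := by
  induction hw using Subgroup.closure_induction_left with
  | one => exact one
  | mul_left x hx y hy ih => obtain ⟨a, ha, rfl⟩ := hx; exact refl_mul a ha y hy ih
  | inv_mul_cancel x hx y hy ih =>
    obtain ⟨a, ha, rfl⟩ := hx
    simpa only [refl_inv] using refl_mul a ha y hy ih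

theorem exists_list_of_mem_weyl {S : Set V} {w : V ≃ₗᵢ[ℝ] V} (hw : w ∈ weyl S) :
    ∃ l : List V, (∀ α ∈ l, α ∈ S) ∧ (l.map refl).prod = w := by
  induction hw using weyl_induction with
  | one => exact ⟨[], by simp, rfl⟩
  | refl_mul a ha w _ ih =>
    obtain ⟨l, hl, rfl⟩ := ih
    exact ⟨a :: l, by simpa [ha] using hl, by simp⟩

theorem apply_eq_self_of_mem_weyl {S : Set V} {v : V} (h : ∀ a ∈ S, ⟪v, a⟫ = 0)
    {w : V ≃ₗᵢ[ℝ] V} (hw : w ∈ weyl S) : w v = v := by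
  induction hw using weyl_induction with
  | one => rfl
  | refl_mul a ha w _ ih => rw [mul_apply, ih, refl_apply_eq_self_iff.2 (h a ha)]

/-! ### Length -/

theorem exists_list_length_eq {Θ : Set V} {w : V ≃ₗᵢ[ℝ] V} (hw : w ∈ weyl Θ) :
    ∃ l : List V, l.length = length Θ w ∧ (∀ α ∈ l, α ∈ Θ) ∧ (l.map refl).prod = w := by
  obtain ⟨l, hl, h⟩ := exists_list_of_mem_weyl hw
  exact Nat.sInf_mem
    (s := {k | ∃ l : List V, l.length = k ∧ (∀ α ∈ l, α ∈ Θ) ∧ (l.map refl).prod = w})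
    ⟨_, l, rfl, hl, h⟩

theorem length_prod_le {Θ : Set V} {l : List V} (hl : ∀ α ∈ l, α ∈ Θ) :
    length Θ (l.map refl).prod ≤ l.length :=
  Nat.sInf_le ⟨l, rfl, hl, rfl⟩

theorem length_le_of_bruhatLE {Φ Θ : Set V} {x y : V ≃ₗᵢ[ℝ] V} (h : bruhatLE Φ Θ x y) :
    length Θ x ≤ length Θ y := by
  induction h with
  | refl => exact le_rfl
  | tail _ h ih => obtain ⟨_, _, _, h⟩ := h; exact ih.trans h.le

/-! ### Weights -/

/-- `v` is a dominant weight of type `S`: its inner product with a simple root vanishes on `S` and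
is positive off `S`. Its stabilizer in the Weyl group is then `weyl S`. -/
structure IsWeight (Θ S : Set V) (v : V) : Prop where
  inner_eq_zero : ∀ a ∈ S, ⟪v, a⟫ = 0
  inner_pos : ∀ a ∈ Θ, a ∉ S → 0 < ⟪v, a⟫

theorem inner_nonneg_of_mem_closure {S : Set V} {v : V} (hv : ∀ a ∈ S, 0 ≤ ⟪v, a⟫) {γ : V}
    (hγ : γ ∈ AddSubmonoid.closure S) : 0 ≤ ⟪v, γ⟫ := by
  induction hγ using AddSubmonoid.closure_induction with
  | mem a ha => exact hv a ha
  | zero => simp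
  | add β γ _ _ hβ hγ => rw [inner_add_right]; exact add_nonneg hβ hγ

namespace IsWeight

variable {Φ Θ S : Set V} {v : V} (hv : IsWeight Θ S v)
include hv

theorem inner_nonneg {a : V} (ha : a ∈ Θ) : 0 ≤ ⟪v, a⟫ := by
  by_cases h : a ∈ S
  · rw [hv.inner_eq_zero a h]
  · exact (hv.inner_pos a ha h).le

theorem inner_posRoot_nonneg {α : V} (hα : α ∈ posRoots Φ Θ) : 0 ≤ ⟪v, α⟫ :=
  inner_nonneg_of_mem_closure (fun _ ha => hv.inner_nonneg ha) hα.2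

theorem mem_iff (hS : S ⊆ Θ) {a : V} : a ∈ S ↔ a ∈ Θ ∧ ⟪v, a⟫ = 0 := by
  refine ⟨fun ha => ⟨hS ha, hv.inner_eq_zero a ha⟩, fun ⟨ha, h0⟩ => ?_⟩
  by_contra h
  exact (hv.inner_pos a ha h).ne' h0

theorem mem_closure {γ : V} (hγ : γ ∈ AddSubmonoid.closure Θ) (h0 : ⟪v, γ⟫ = 0) :
    γ ∈ AddSubmonoid.closure S := by
  induction hγ using AddSubmonoid.closure_induction with
  | mem a ha =>
    by_cases h : a ∈ S
    · exact AddSubmonoid.subset_closure h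
    · exact absurd h0 (hv.inner_pos a ha h).ne'
  | zero => exact zero_mem _
  | add β γ hβ hγ ihβ ihγ =>
    have hβ0 := inner_nonneg_of_mem_closure (fun a ha => hv.inner_nonneg ha) hβ
    have hγ0 := inner_nonneg_of_mem_closure (fun a ha => hv.inner_nonneg ha) hγ
    rw [inner_add_right] at h0
    exact add_mem (ihβ (by linarith)) (ihγ (by linarith))

theorem apply_eq_self {w : V ≃ₗᵢ[ℝ] V} (hw : w ∈ weyl S) : w v = v :=
  apply_eq_self_of_mem_weyl hv.inner_eq_zero hw

end IsWeight

/-! ### Root systems with a base -/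

/-- `Φ` is a root system and `Θ` a base of it, in the form needed for the combinatorics of the Weyl
group. The linear independence of `Θ` enters through the existence of weights of every type. -/
structure IsRootBase (Φ Θ : Set V) : Prop where
  subset : Θ ⊆ Φ
  zero_notMem : 0 ∉ Φ
  refl_mem : ∀ α ∈ Φ, ∀ β ∈ Φ, refl α β ∈ Φ
  reduced : ∀ a ∈ Θ, ∀ k : ℕ, k • a ∈ Φ → k = 1
  pos_or_neg : ∀ α ∈ Φ, α ∈ posRoots Φ Θ ∨ -α ∈ posRoots Φ Θ
  refl_mem_weyl : ∀ α ∈ Φ, refl α ∈ weyl Θ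
  exists_weight : ∀ S ⊆ Θ, ∃ v, IsWeight Θ S v

namespace IsRootBase

variable {Φ Θ ΘP ΘQ S : Set V} (hΦ : IsRootBase Φ Θ)
include hΦ

theorem apply_mem {w : V ≃ₗᵢ[ℝ] V} (hw : w ∈ weyl Θ) {α : V} (hα : α ∈ Φ) : w α ∈ Φ := by
  induction hw using weyl_induction with
  | one => exact hα
  | refl_mul a ha w _ ih => exact hΦ.refl_mem a (hΦ.subset ha) _ ih

theorem simple_mem_posRoots {a : V} (ha : a ∈ Θ) : a ∈ posRoots Φ Θ :=
  ⟨hΦ.subset ha, AddSubmonoid.subset_closure ha⟩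

theorem apply_pos_or_neg {w : V ≃ₗᵢ[ℝ] V} (hw : w ∈ weyl Θ) {α : V} (hα : α ∈ posRoots Φ Θ) :
    w α ∈ posRoots Φ Θ ∨ -(w α) ∈ posRoots Φ Θ :=
  hΦ.pos_or_neg _ (hΦ.apply_mem hw hα.1)

theorem inner_pos_of_isWeight_empty {ρ : V} (hρ : IsWeight Θ ∅ ρ) {α : V}
    (hα : α ∈ posRoots Φ Θ) : 0 < ⟪ρ, α⟫ := by
  refine (hρ.inner_posRoot_nonneg hα).lt_of_ne' fun h0 => hΦ.zero_notMem ?_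
  have hα0 := hρ.mem_closure hα.2 h0
  rw [AddSubmonoid.closure_empty, AddSubmonoid.mem_bot] at hα0
  exact hα0 ▸ hα.1

theorem neg_notMem {α : V} (hα : α ∈ posRoots Φ Θ) : -α ∉ posRoots Φ Θ := by
  obtain ⟨ρ, hρ⟩ := hΦ.exists_weight ∅ (Set.empty_subset _)
  intro hα'
  have hneg := hΦ.inner_pos_of_isWeight_empty hρ hα'
  rw [inner_neg_right] at hneg
  linarith [hΦ.inner_pos_of_isWeight_empty hρ hα]

theorem mem_posRoots_of_inner_pos {v : V} (hv : IsWeight Θ S v) {α : V} (hα : α ∈ Φ)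
    (h : 0 < ⟪v, α⟫) : α ∈ posRoots Φ Θ := by
  refine (hΦ.pos_or_neg α hα).resolve_right fun hneg => ?_
  have hle := hv.inner_posRoot_nonneg hneg
  rw [inner_neg_right] at hle
  linarith

theorem refl_simple_mem_posRoots {a : V} (ha : a ∈ Θ) {β : V} (hβ : β ∈ posRoots Φ Θ)
    (hne : β ≠ a) : refl a β ∈ posRoots Φ Θ := by
  refine (hΦ.pos_or_neg _ (hΦ.refl_mem a (hΦ.subset ha) β hβ.1)).resolve_right fun hneg => hne ?_
  obtain ⟨v, hv⟩ := hΦ.exists_weight {a} (Set.singleton_subset_iff.2 ha)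
  have hva : refl a v = v := refl_apply_eq_self_iff.2 (hv.inner_eq_zero a rfl)
  have hle := hv.inner_posRoot_nonneg hneg
  rw [inner_neg_right, inner_apply_of_apply_eq hva] at hle
  have hmem := hv.mem_closure hβ.2 (le_antisymm (by linarith) (hv.inner_posRoot_nonneg hβ))
  obtain ⟨k, rfl⟩ := AddSubmonoid.mem_closure_singleton.1 hmem
  rw [hΦ.reduced a ha k hβ.1, one_smul]

theorem strong_exchange (hS : S ⊆ Θ) {l : List V} (hl : ∀ a ∈ l, a ∈ S) {α : V}
    (hα : α ∈ posRoots Φ Θ) (h : -((l.map refl).prod⁻¹ α) ∈ posRoots Φ Θ) :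
    ∃ l' : List V, l'.length < l.length ∧ (∀ a ∈ l', a ∈ S) ∧
      (l'.map refl).prod = refl α * (l.map refl).prod := by
  induction l generalizing α with
  | nil => exact absurd h (hΦ.neg_notMem hα)
  | cons a t ih =>
    obtain ⟨ha, ht⟩ := List.forall_mem_cons.1 hl
    by_cases hαa : α = a
    · exact ⟨t, by simp, ht, by simp [hαa, refl_mul_refl_mul]⟩
    · obtain ⟨t', hlen, ht', hprod⟩ := ih ht (hΦ.refl_simple_mem_posRoots (hS ha) hα hαa)
        (by simpa [mul_inv_rev] using h)
      refine ⟨a :: t', by simpa using hlen, List.forall_mem_cons.2 ⟨ha, ht'⟩, ?_⟩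
      rw [List.map_cons, List.prod_cons, hprod, List.map_cons, List.prod_cons, refl_map, refl_inv]
      simp only [mul_assoc, refl_mul_refl_mul]

theorem length_refl_mul_lt {x : V ≃ₗᵢ[ℝ] V} (hx : x ∈ weyl Θ) {α : V} (hα : α ∈ posRoots Φ Θ)
    (h : -(x⁻¹ α) ∈ posRoots Φ Θ) : length Θ (refl α * x) < length Θ x := by
  obtain ⟨l, hlen, hl, rfl⟩ := exists_list_length_eq hx
  obtain ⟨l', hlen', hl', hprod⟩ := hΦ.strong_exchange subset_rfl hl hα h
  rw [← hprod, ← hlen]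
  exact (length_prod_le hl').trans_lt hlen'

theorem lt_length_refl_mul {x : V ≃ₗᵢ[ℝ] V} (hx : x ∈ weyl Θ) {α : V} (hα : α ∈ posRoots Φ Θ)
    (h : x⁻¹ α ∈ posRoots Φ Θ) : length Θ x < length Θ (refl α * x) := by
  have hlt := hΦ.length_refl_mul_lt (mul_mem (hΦ.refl_mem_weyl α hα.1) hx) hα
    (by rwa [mul_inv_rev, refl_inv, mul_apply, refl_self, map_neg, neg_neg])
  rwa [refl_mul_refl_mul] at hlt

theorem bruhatLE_refl_mul_iff {x : V ≃ₗᵢ[ℝ] V} (hx : x ∈ weyl Θ) {α : V}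
    (hα : α ∈ posRoots Φ Θ) : bruhatLE Φ Θ x (refl α * x) ↔ x⁻¹ α ∈ posRoots Φ Θ := by
  constructor
  · intro h
    refine (hΦ.apply_pos_or_neg (inv_mem hx) hα).resolve_right fun hneg => ?_
    exact (hΦ.length_refl_mul_lt hx hα hneg).not_ge (length_le_of_bruhatLE h)
  · intro h
    exact Relation.ReflTransGen.single ⟨α, hα, rfl, hΦ.lt_length_refl_mul hx hα h⟩

theorem exists_descent (hS : S ⊆ Θ) {x : V ≃ₗᵢ[ℝ] V} (hx : x ∈ weyl S) (hx1 : x ≠ 1) :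
    ∃ a ∈ S, -(x⁻¹ a) ∈ posRoots Φ Θ ∧ length S (refl a * x) < length S x := by
  obtain ⟨l, hlen, hl, hlx⟩ := exists_list_length_eq hx
  obtain _ | ⟨a, t⟩ := l
  · exact absurd hlx.symm hx1
  obtain ⟨ha, ht⟩ := List.forall_mem_cons.1 hl
  have hxt : refl a * x = (t.map refl).prod := by simp [← hlx, refl_mul_refl_mul]
  have haΦ := hΦ.simple_mem_posRoots (hS ha)
  refine ⟨a, ha, (hΦ.apply_pos_or_neg (weyl_mono hS (inv_mem hx)) haΦ).resolve_left fun hpos => ?_,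
    by rw [hxt, ← hlen]; exact Nat.lt_succ_of_le (length_prod_le ht)⟩
  obtain ⟨l', hlen', hl', hprod⟩ := hΦ.strong_exchange hS ht haΦ
    (by rwa [← hxt, mul_inv_rev, refl_inv, mul_apply, refl_self, map_neg, neg_neg])
  rw [← hxt, refl_mul_refl_mul] at hprod
  have hle := length_prod_le hl'
  rw [hprod, ← hlen, List.length_cons] at hle
  omega

theorem mem_weyl_of_dominant (hS : S ⊆ Θ) {x : V ≃ₗᵢ[ℝ] V} (hx : x ∈ weyl S) {v : V}
    (hv : ∀ a ∈ S, 0 ≤ ⟪v, a⟫) (hxv : ∀ a ∈ S, 0 ≤ ⟪x⁻¹ v, a⟫) :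
    x ∈ weyl {a | a ∈ S ∧ ⟪v, a⟫ = 0} := by
  induction hk : length S x using Nat.strong_induction_on generalizing x with
  | _ k ih =>
  rcases eq_or_ne x 1 with rfl | hx1
  · exact one_mem _
  obtain ⟨a, ha, hneg, hlt⟩ := hΦ.exists_descent hS hx hx1
  have hcl : -(x⁻¹ a) ∈ AddSubmonoid.closure S := by
    obtain ⟨w, hw⟩ := hΦ.exists_weight S hS
    refine hw.mem_closure hneg.2 ?_
    rw [inner_neg_right, inner_apply_of_apply_eq (hw.apply_eq_self (inv_mem hx)),
      hw.inner_eq_zero a ha, neg_zero]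
  have h0 : ⟪v, a⟫ = 0 := by
    have hle := inner_nonneg_of_mem_closure hxv hcl
    rw [inner_neg_right, LinearIsometryEquiv.inner_map_map] at hle
    exact le_antisymm (by linarith) (hv a ha)
  have hsv : (refl a * x)⁻¹ v = x⁻¹ v := by
    rw [mul_inv_rev, refl_inv, mul_apply, refl_apply_eq_self_iff.2 h0]
  rw [← refl_mul_refl_mul a x]
  exact mul_mem (refl_mem_weyl_of_mem ⟨ha, h0⟩)
    (ih _ (hk ▸ hlt) (mul_mem (refl_mem_weyl_of_mem ha) hx) (by rwa [hsv]) rfl)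

theorem mem_weyl_iff {v : V} (hS : S ⊆ Θ) (hv : IsWeight Θ S v) {w : V ≃ₗᵢ[ℝ] V} :
    w ∈ weyl S ↔ w ∈ weyl Θ ∧ w v = v := by
  refine ⟨fun hw => ⟨weyl_mono hS hw, hv.apply_eq_self hw⟩, fun ⟨hw, h⟩ => ?_⟩
  refine weyl_mono (fun a ha => (hv.mem_iff hS).2 ha) ?_
  have hdom : ∀ a ∈ Θ, 0 ≤ ⟪v, a⟫ := fun a ha => hv.inner_nonneg ha
  exact hΦ.mem_weyl_of_dominant subset_rfl hw hdom (by rwa [inv_apply_eq_iff.2 h.symm])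

/-! ### Representatives of cosets -/

theorem apply_mem_of_mem_doubleReps (hP : ΘP ⊆ Θ) {x : V ≃ₗᵢ[ℝ] V}
    (hx : x ∈ doubleReps Θ ΘQ ΘP) {a : V} (ha : a ∈ ΘP) : x a ∈ posRoots Φ Θ := by
  refine (hΦ.apply_pos_or_neg hx.1 (hΦ.simple_mem_posRoots (hP ha))).resolve_right fun h => ?_
  have hlt := hΦ.length_refl_mul_lt hx.1 h
    (by rw [map_neg, neg_neg, inv_apply_apply]; exact hΦ.simple_mem_posRoots (hP ha))
  rw [refl_neg, refl_map, inv_mul_cancel_right] at hlt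
  exact hlt.not_ge (hx.2 _ ⟨1, one_mem _, _, refl_mem_weyl_of_mem ha, by rw [one_mul]⟩)

theorem inv_apply_mem_of_mem_doubleReps (hQ : ΘQ ⊆ Θ) {x : V ≃ₗᵢ[ℝ] V}
    (hx : x ∈ doubleReps Θ ΘQ ΘP) {a : V} (ha : a ∈ ΘQ) : x⁻¹ a ∈ posRoots Φ Θ := by
  have haΦ := hΦ.simple_mem_posRoots (hQ ha)
  refine (hΦ.apply_pos_or_neg (inv_mem hx.1) haΦ).resolve_right fun h => ?_
  exact (hΦ.length_refl_mul_lt hx.1 haΦ h).not_ge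
    (hx.2 _ ⟨_, refl_mem_weyl_of_mem ha, 1, one_mem _, by rw [mul_one]⟩)

theorem eq_of_mem_leftReps_of_inv_mul_mem (hP : ΘP ⊆ Θ) {x y : V ≃ₗᵢ[ℝ] V}
    (hx : x ∈ leftReps Θ ΘP) (hy : y ∈ leftReps Θ ΘP) (h : x⁻¹ * y ∈ weyl ΘP) : x = y := by
  obtain ⟨ρ, hρ⟩ := hΦ.exists_weight ∅ (Set.empty_subset _)
  have hdom : ∀ z ∈ leftReps Θ ΘP, ∀ a ∈ ΘP, 0 < ⟪z⁻¹ ρ, a⟫ := by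
    intro z hz a ha
    rw [inner_inv_apply_left]
    exact hΦ.inner_pos_of_isWeight_empty hρ (hΦ.apply_mem_of_mem_doubleReps hP hz ha)
  have hmem := hΦ.mem_weyl_of_dominant hP h (v := x⁻¹ ρ) (fun a ha => (hdom x hx a ha).le)
    (by simpa [mul_inv_rev, mul_apply, apply_inv_apply] using fun a ha => (hdom y hy a ha).le)
  have hempty : {a | a ∈ ΘP ∧ ⟪x⁻¹ ρ, a⟫ = 0} = ∅ :=
    Set.eq_empty_of_forall_notMem fun a ha => (hdom x hx a ha.1).ne' ha.2
  rw [hempty, weyl_empty, Subgroup.mem_bot] at hmem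
  exact inv_mul_eq_one.1 hmem

omit hΦ in
theorem doubleReps_subset_leftReps : doubleReps Θ ΘQ ΘP ⊆ leftReps Θ ΘP := by
  rintro x ⟨hx, h⟩
  refine ⟨hx, ?_⟩
  rintro y ⟨a, ha, b, hb, rfl⟩
  exact h _ ⟨a, weyl_mono (Set.empty_subset _) ha, b, hb, rfl⟩

variable {u v : V}

theorem leftReps_eq_of_apply_eq (hP : ΘP ⊆ Θ) (hv : IsWeight Θ ΘP v) {x y : V ≃ₗᵢ[ℝ] V}
    (hx : x ∈ leftReps Θ ΘP) (hy : y ∈ leftReps Θ ΘP) (h : x v = y v) : x = y := by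
  refine hΦ.eq_of_mem_leftReps_of_inv_mul_mem hP hx hy
    ((hΦ.mem_weyl_iff hP hv).2 ⟨mul_mem (inv_mem hx.1) hy.1, ?_⟩)
  rw [mul_apply, ← h, inv_apply_apply]

theorem doubleReps_eq_of_apply_eq (hP : ΘP ⊆ Θ) (hQ : ΘQ ⊆ Θ) (hv : IsWeight Θ ΘP v)
    {x y : V ≃ₗᵢ[ℝ] V} (hx : x ∈ doubleReps Θ ΘQ ΘP) (hy : y ∈ doubleReps Θ ΘQ ΘP)
    {c : V ≃ₗᵢ[ℝ] V} (hc : c ∈ weyl ΘQ) (h : c (x v) = y v) : x = y := by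
  have hdom : ∀ z ∈ doubleReps Θ ΘQ ΘP, ∀ a ∈ ΘQ, 0 ≤ ⟪z v, a⟫ := by
    intro z hz a ha
    rw [inner_apply_left]
    exact hv.inner_posRoot_nonneg (hΦ.inv_apply_mem_of_mem_doubleReps hQ hz ha)
  have hmem := hΦ.mem_weyl_of_dominant hQ (inv_mem hc) (hdom x hx)
    (by rw [inv_inv, h]; exact hdom y hy)
  have hcx : c (x v) = x v := apply_eq_self_of_mem_weyl (fun a ha => ha.2) (inv_mem_iff.1 hmem)
  exact hΦ.leftReps_eq_of_apply_eq hP hv (doubleReps_subset_leftReps hx)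
    (doubleReps_subset_leftReps hy) (hcx.symm.trans h)

omit hΦ in
theorem hat_mem_doubleCoset (w : V ≃ₗᵢ[ℝ] V) : hat Θ ΘQ ΘP w ∈ doubleCoset ΘQ ΘP w :=
  Function.argminOn_mem _ _ _

omit hΦ in
theorem hat_mem (hP : ΘP ⊆ Θ) (hQ : ΘQ ⊆ Θ) {w : V ≃ₗᵢ[ℝ] V} (hw : w ∈ weyl Θ) :
    hat Θ ΘQ ΘP w ∈ doubleReps Θ ΘQ ΘP := by
  obtain ⟨a, ha, b, hb, h⟩ := hat_mem_doubleCoset (Θ := Θ) (ΘQ := ΘQ) (ΘP := ΘP) w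
  refine ⟨h ▸ mul_mem (mul_mem (weyl_mono hQ ha) hw) (weyl_mono hP hb), ?_⟩
  rintro y ⟨c, hc, d, hd, rfl⟩
  have hmem : c * hat Θ ΘQ ΘP w * d ∈ doubleCoset ΘQ ΘP w :=
    ⟨c * a, mul_mem hc ha, b * d, mul_mem hb hd, by rw [h]; simp only [mul_assoc]⟩
  exact Function.argminOn_le _ _ hmem

omit hΦ in
theorem exists_apply_hat_eq (hv : IsWeight Θ ΘP v) (w : V ≃ₗᵢ[ℝ] V) :
    ∃ c ∈ weyl ΘQ, c (hat Θ ΘQ ΘP w v) = w v := by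
  obtain ⟨a, ha, b, hb, h⟩ := hat_mem_doubleCoset (Θ := Θ) (ΘQ := ΘQ) (ΘP := ΘP) w
  refine ⟨a⁻¹, inv_mem ha, ?_⟩
  rw [h, mul_apply, mul_apply, inv_apply_apply, hv.apply_eq_self hb]

theorem hat_eq_iff (hP : ΘP ⊆ Θ) (hQ : ΘQ ⊆ Θ) (hv : IsWeight Θ ΘP v) {x y : V ≃ₗᵢ[ℝ] V}
    (hx : x ∈ weyl Θ) (hy : y ∈ weyl Θ) :
    hat Θ ΘQ ΘP x = hat Θ ΘQ ΘP y ↔ ∃ c ∈ weyl ΘQ, c (x v) = y v := by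
  obtain ⟨a, ha, hax⟩ := exists_apply_hat_eq (ΘQ := ΘQ) hv x
  obtain ⟨b, hb, hby⟩ := exists_apply_hat_eq (ΘQ := ΘQ) hv y
  constructor
  · intro h
    refine ⟨b * a⁻¹, mul_mem hb (inv_mem ha), ?_⟩
    rw [← hax, mul_apply, inv_apply_apply, h, hby]
  · rintro ⟨c, hc, h⟩
    refine hΦ.doubleReps_eq_of_apply_eq hP hQ hv (hat_mem hP hQ hx) (hat_mem hP hQ hy)
      (c := b⁻¹ * c * a) (mul_mem (mul_mem (inv_mem hb) hc) ha) ?_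
    rw [mul_apply, mul_apply, hax, h, ← hby, inv_apply_apply]

theorem hat_eq_self (hP : ΘP ⊆ Θ) (hQ : ΘQ ⊆ Θ) {x : V ≃ₗᵢ[ℝ] V}
    (hx : x ∈ doubleReps Θ ΘQ ΘP) : hat Θ ΘQ ΘP x = x := by
  obtain ⟨v, hv⟩ := hΦ.exists_weight ΘP hP
  obtain ⟨a, ha, hax⟩ := exists_apply_hat_eq (ΘQ := ΘQ) hv x
  exact hΦ.doubleReps_eq_of_apply_eq hP hQ hv (hat_mem hP hQ hx.1) hx ha hax

omit hΦ in
theorem bar_mem (hP : ΘP ⊆ Θ) {w : V ≃ₗᵢ[ℝ] V} (hw : w ∈ weyl Θ) :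
    bar Θ ΘP w ∈ leftReps Θ ΘP :=
  hat_mem hP (Set.empty_subset _) hw

omit hΦ in
theorem bar_apply (hv : IsWeight Θ ΘP v) (w : V ≃ₗᵢ[ℝ] V) : bar Θ ΘP w v = w v := by
  obtain ⟨c, hc, h⟩ := exists_apply_hat_eq (ΘQ := ∅) hv w
  rw [weyl_empty, Subgroup.mem_bot] at hc
  rwa [hc] at h

theorem eq_bar_iff (hP : ΘP ⊆ Θ) (hv : IsWeight Θ ΘP v) {x y : V ≃ₗᵢ[ℝ] V}
    (hx : x ∈ leftReps Θ ΘP) (hy : y ∈ weyl Θ) : x = bar Θ ΘP y ↔ x v = y v := by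
  rw [← bar_apply hv y]
  exact ⟨fun h => h ▸ rfl, hΦ.leftReps_eq_of_apply_eq hP hv hx (bar_mem hP hy)⟩

/-! ### Edges -/

theorem refl_mul_mem {α : V} (hα : α ∈ posRoots Φ Θ) {x : V ≃ₗᵢ[ℝ] V} (hx : x ∈ weyl Θ) :
    refl α * x ∈ weyl Θ :=
  mul_mem (hΦ.refl_mem_weyl α hα.1) hx

theorem bruhatLE_and_ne_iff (hv : IsWeight Θ ΘP v) {x : V ≃ₗᵢ[ℝ] V}
    (hx : x ∈ weyl Θ) {α : V} (hα : α ∈ posRoots Φ Θ) :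
    bruhatLE Φ Θ x (refl α * x) ∧ x v ≠ refl α (x v) ↔ 0 < ⟪x v, α⟫ := by
  rw [hΦ.bruhatLE_refl_mul_iff hx hα, ne_comm, Ne, refl_apply_eq_self_iff, inner_apply_left]
  exact ⟨fun ⟨hpos, hne⟩ => (hv.inner_posRoot_nonneg hpos).lt_of_ne' hne,
    fun h => ⟨hΦ.mem_posRoots_of_inner_pos hv (hΦ.apply_mem (inv_mem hx) hα.1) h, h.ne'⟩⟩

theorem parabolicGraph_edge_iff (hP : ΘP ⊆ Θ) (hv : IsWeight Θ ΘP v) {x y : V ≃ₗᵢ[ℝ] V} {α : V} :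
    (parabolicGraph Φ Θ ΘP).edge x y α ↔ x ∈ leftReps Θ ΘP ∧ y ∈ leftReps Θ ΘP ∧
      α ∈ posRoots Φ Θ ∧ 0 < ⟪x v, α⟫ ∧ y v = refl α (x v) := by
  have hne (hx : x ∈ leftReps Θ ΘP) (hα : α ∈ posRoots Φ Θ) :
      bar Θ ΘP x ≠ bar Θ ΘP (refl α * x) ↔ x v ≠ refl α (x v) := by
    rw [Ne, hΦ.eq_bar_iff hP hv (bar_mem hP hx.1) (hΦ.refl_mul_mem hα hx.1), bar_apply hv,
      mul_apply]
  constructor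
  · rintro ⟨hx, hα, hle, hbar, rfl⟩
    exact ⟨hx, bar_mem hP (hΦ.refl_mul_mem hα hx.1), hα,
      (hΦ.bruhatLE_and_ne_iff hv hx.1 hα).1 ⟨hle, (hne hx hα).1 hbar⟩, bar_apply hv _⟩
  · rintro ⟨hx, hy, hα, hpos, hyv⟩
    obtain ⟨hle, hxv⟩ := (hΦ.bruhatLE_and_ne_iff hv hx.1 hα).2 hpos
    exact ⟨hx, hα, hle, (hne hx hα).2 hxv, (hΦ.eq_bar_iff hP hv hy (hΦ.refl_mul_mem hα hx.1)).2 hyv⟩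

theorem exists_mem_weyl_apply_eq_refl_iff (hQ : ΘQ ⊆ Θ) (hu : IsWeight Θ ΘQ u) {x α : V}
    (hα : α ∈ Φ) (hx : ⟪x, α⟫ ≠ 0) : (∃ c ∈ weyl ΘQ, c x = refl α x) ↔ ⟪u, α⟫ = 0 := by
  refine ⟨fun ⟨c, hc, hcx⟩ => ?_, fun h => ⟨refl α, (hΦ.mem_weyl_iff hQ hu).2
    ⟨hΦ.refl_mem_weyl α hα, refl_apply_eq_self_iff.2 h⟩, rfl⟩⟩
  have hinner := inner_apply_of_apply_eq (hu.apply_eq_self hc) x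
  rw [hcx] at hinner
  exact (inner_refl_eq_iff.1 hinner).resolve_right hx

theorem mem_admissibleLabels_and_ne_iff (hP : ΘP ⊆ Θ) (hQ : ΘQ ⊆ Θ) (hv : IsWeight Θ ΘP v)
    (hu : IsWeight Θ ΘQ u) {x y : V ≃ₗᵢ[ℝ] V} (hx : x ∈ doubleReps Θ ΘQ ΘP) {β : V} :
    β ∈ admissibleLabels Φ Θ ΘQ ΘP x y ∧ x ≠ y ↔
      β ∈ Φ ∧ y = hat Θ ΘQ ΘP (refl β * x) ∧ 0 < ⟪x v, β⟫ ∧ 0 < ⟪u, β⟫ := by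
  have hne (hβ : β ∈ posRoots Φ Θ) :
      x ≠ hat Θ ΘQ ΘP (refl β * x) ↔ ¬∃ c ∈ weyl ΘQ, c (x v) = refl β (x v) := by
    rw [← mul_apply (refl β), ← hΦ.hat_eq_iff hP hQ hv hx.1 (hΦ.refl_mul_mem hβ hx.1),
      hΦ.hat_eq_self hP hQ hx]
  constructor
  · rintro ⟨⟨hβ, rfl, hle⟩, hxy⟩
    rw [hne hβ] at hxy
    have hpos := (hΦ.bruhatLE_and_ne_iff hv hx.1 hβ).1
      ⟨hle, fun h => hxy ⟨1, one_mem _, h⟩⟩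
    rw [hΦ.exists_mem_weyl_apply_eq_refl_iff hQ hu hβ.1 hpos.ne'] at hxy
    exact ⟨hβ.1, rfl, hpos, (hu.inner_posRoot_nonneg hβ).lt_of_ne' hxy⟩
  · rintro ⟨hβ, rfl, hxβ, huβ⟩
    have hpos := hΦ.mem_posRoots_of_inner_pos hu hβ huβ
    refine ⟨⟨hpos, rfl, ((hΦ.bruhatLE_and_ne_iff hv hx.1 hpos).2 hxβ).1⟩, ?_⟩
    rw [hne hpos, hΦ.exists_mem_weyl_apply_eq_refl_iff hQ hu hβ hxβ.ne']
    exact huβ.ne'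

section Closure

variable (hP : ΘP ⊆ Θ) (hQ : ΘQ ⊆ Θ) (hv : IsWeight Θ ΘP v) (hu : IsWeight Θ ΘQ u)
  (𝒟 : DoubleMomentGraph Φ Θ ΘQ ΘP)
include hP hQ hv hu

theorem toSubgraph_edge_iff {x y : V ≃ₗᵢ[ℝ] V} {α : V} :
    𝒟.toSubgraph.edge x y α ↔ x ∈ doubleReps Θ ΘQ ΘP ∧ α ∈ Φ ∧ 0 < ⟪x v, α⟫ ∧ 0 < ⟪u, α⟫ ∧
      y = bar Θ ΘP (refl α * x) ∧ α = 𝒟.label x (hat Θ ΘQ ΘP (refl α * x)) := by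
  constructor
  · rintro ⟨x', hx', rfl, hy⟩
    obtain ⟨hα, hhat, hxα, huα⟩ := (hΦ.mem_admissibleLabels_and_ne_iff hP hQ hv hu hx'.1).1
      ⟨𝒟.label_mem _ _ hx', hx'.2.2⟩
    exact ⟨hx'.1, hα, hxα, huα, hy, by rw [← hhat]⟩
  · rintro ⟨hx, hα, hxα, huα, hy, hlabel⟩
    obtain ⟨hadm, hne⟩ :=
      (hΦ.mem_admissibleLabels_and_ne_iff hP hQ hv hu hx).2 ⟨hα, rfl, hxα, huα⟩
    exact ⟨_, ⟨hx, ⟨α, hadm⟩, hne⟩, hlabel, hy⟩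

theorem label_hat_spec {x : V ≃ₗᵢ[ℝ] V} (hx : x ∈ doubleReps Θ ΘQ ΘP) {β : V} (hβ : β ∈ Φ)
    (hxβ : 0 < ⟪x v, β⟫) (huβ : 0 < ⟪u, β⟫) {α : V}
    (hα : α = 𝒟.label x (hat Θ ΘQ ΘP (refl β * x))) :
    𝒟.toSubgraph.edge x (bar Θ ΘP (refl α * x)) α ∧ α ∈ Φ ∧ 0 < ⟪x v, α⟫ ∧ 0 < ⟪u, α⟫ ∧
      hat Θ ΘQ ΘP (refl α * x) = hat Θ ΘQ ΘP (refl β * x) := by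
  obtain ⟨hadm, hne⟩ := (hΦ.mem_admissibleLabels_and_ne_iff hP hQ hv hu hx).2 ⟨hβ, rfl, hxβ, huβ⟩
  have hedge : doubleEdge Φ Θ ΘQ ΘP x (hat Θ ΘQ ΘP (refl β * x)) := ⟨hx, ⟨β, hadm⟩, hne⟩
  obtain ⟨hαΦ, hhat, hxα, huα⟩ := (hΦ.mem_admissibleLabels_and_ne_iff hP hQ hv hu hx).1
    ⟨hα ▸ 𝒟.label_mem _ _ hedge, hne⟩
  exact ⟨⟨_, hedge, hα, rfl⟩, hαΦ, hxα, huα, hhat.symm⟩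

omit hu in
theorem eq_bar_mul_hat {x c : V ≃ₗᵢ[ℝ] V} (hx : x ∈ leftReps Θ ΘP) (hc : c ∈ weyl ΘQ)
    (h : c (hat Θ ΘQ ΘP x v) = x v) : x = bar Θ ΘP (c * hat Θ ΘQ ΘP x) :=
  (hΦ.eq_bar_iff hP hv hx (mul_mem (weyl_mono hQ hc) (hat_mem hP hQ hx.1).1)).2 h.symm

omit hu in
theorem closure_verts : 𝒟.closure.verts = leftReps Θ ΘP := by
  have hsub : 𝒟.toSubgraph.verts ⊆ leftReps Θ ΘP := by
    rintro x (hx | ⟨y, y', h, rfl⟩)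
    · exact doubleReps_subset_leftReps hx
    · exact bar_mem hP (hΦ.refl_mul_mem (𝒟.label_mem _ _ h).1 h.1.1)
  ext x
  constructor
  · rintro ⟨c, hc, y, hy, rfl⟩
    exact bar_mem hP (mul_mem (weyl_mono hQ hc) (hsub hy).1)
  · intro hx
    obtain ⟨c, hc, hcx⟩ := exists_apply_hat_eq (ΘQ := ΘQ) hv x
    exact ⟨c, hc, _, Or.inl (hat_mem hP hQ hx.1), hΦ.eq_bar_mul_hat hP hQ hv hx hc hcx⟩

/-- The inner products with `u`, which is fixed by `W_Q`, keep the direction of a translated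
edge. -/
theorem parabolicGraph_edge_of_toSubgraph_edge {a b : V ≃ₗᵢ[ℝ] V} {α : V}
    (h : 𝒟.toSubgraph.edge a b α) {c : V ≃ₗᵢ[ℝ] V} (hc : c ∈ weyl ΘQ) :
    (parabolicGraph Φ Θ ΘP).edge (bar Θ ΘP (c * a)) (bar Θ ΘP (c * b)) (c α) := by
  obtain ⟨ha, hα, haα, huα, rfl, -⟩ := (hΦ.toSubgraph_edge_iff hP hQ hv hu 𝒟).1 h
  have hcΘ := weyl_mono hQ hc
  have hb := bar_mem hP (mul_mem (hΦ.refl_mem_weyl α hα) ha.1)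
  refine (hΦ.parabolicGraph_edge_iff hP hv).2 ⟨bar_mem hP (mul_mem hcΘ ha.1),
    bar_mem hP (mul_mem hcΘ hb.1), hΦ.mem_posRoots_of_inner_pos hu (hΦ.apply_mem hcΘ hα) ?_, ?_, ?_⟩
  · rwa [inner_apply_of_apply_eq (hu.apply_eq_self hc)]
  · rwa [bar_apply hv, mul_apply, LinearIsometryEquiv.inner_map_map]
  · simp only [bar_apply hv, mul_apply, refl_apply_apply]

theorem closure_edge_iff {x y : V ≃ₗᵢ[ℝ] V} {γ : V} : 𝒟.closure.edge x y γ ↔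
    ((parabolicGraph Φ Θ ΘP).edge x y γ ∧ ∃ c ∈ weyl ΘQ, c (x v) = y v) ∨
    ∃ a b α, 𝒟.toSubgraph.edge a b α ∧ ∃ c ∈ weyl ΘQ,
      x = bar Θ ΘP (c * a) ∧ y = bar Θ ΘP (c * b) ∧ γ = c α := by
  have hpos {a b α} (h : 𝒟.toSubgraph.edge a b α) {c} (hc : c ∈ weyl ΘQ) : c α ∈ posRoots Φ Θ :=
    ((hΦ.parabolicGraph_edge_iff hP hv).1
      (hΦ.parabolicGraph_edge_of_toSubgraph_edge hP hQ hv hu 𝒟 h hc)).2.2.1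
  constructor
  · rintro (⟨h, z, -, c, hc, d, hd, rfl, rfl⟩ | ⟨a, b, α, h, c, hc, -, hx, hy, hγ⟩ |
      ⟨a, b, α, h, c, hc, hneg, -⟩)
    · refine Or.inl ⟨h, d * c⁻¹, mul_mem hd (inv_mem hc), ?_⟩
      simp only [bar_apply hv, mul_apply, inv_apply_apply]
    · exact Or.inr ⟨a, b, α, h, c, hc, hx, hy, hγ⟩
    · exact absurd hneg (hΦ.neg_notMem (hpos h hc))
  · rintro (⟨h, d, hd, hxy⟩ | ⟨a, b, α, h, c, hc, rfl, rfl, rfl⟩)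
    · obtain ⟨hx, hy, -⟩ := (hΦ.parabolicGraph_edge_iff hP hv).1 h
      obtain ⟨c, hc, hcx⟩ := exists_apply_hat_eq (ΘQ := ΘQ) hv x
      refine Or.inl ⟨h, _, Or.inl (hat_mem hP hQ hx.1), c, hc, d * c, mul_mem hd hc,
        hΦ.eq_bar_mul_hat hP hQ hv hx hc hcx, ?_⟩
      refine (hΦ.eq_bar_iff hP hv hy
        (mul_mem (weyl_mono hQ (mul_mem hd hc)) (hat_mem hP hQ hx.1).1)).2 ?_
      rw [mul_apply, mul_apply, hcx, hxy]
    · exact Or.inr (Or.inl ⟨a, b, α, h, c, hc, hpos h hc, rfl, rfl, rfl⟩)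

end Closure

end IsRootBase

/-! ### The criterion for closedness -/

/-- The condition on edges at `x` under which the graph is closed, for the stabilizer `W_u` of `u`:
of the edges `x → s_α x` and `x → s_β x` that leave `x` upwards and outside `W_u x`, those whose
ends lie in the same `W_u`-orbit are conjugate under the stabilizer of `u` and `x`. -/
def EdgesConjugateAt (Φ Θ : Set V) (u x : V) : Prop :=
  ∀ α ∈ Φ, ∀ β ∈ Φ, 0 < ⟪u, α⟫ → 0 < ⟪u, β⟫ → 0 < ⟪x, α⟫ → 0 < ⟪x, β⟫ →
    (∃ c ∈ weyl Θ, c u = u ∧ c (refl α x) = refl β x) →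
    ∃ c ∈ weyl Θ, c u = u ∧ c x = x ∧ c α = β

/-- The condition `EdgesConjugateAt` at all points of the orbit `W v`, whose points are the vertices
of the parabolic moment graph when `v` is a weight of type `Θ_P`. -/
def EdgesConjugate (Φ Θ : Set V) (u v : V) : Prop :=
  ∀ w ∈ weyl Θ, EdgesConjugateAt Φ Θ u (w v)

namespace IsRootBase

variable {Φ Θ ΘP ΘQ : Set V} (hΦ : IsRootBase Φ Θ) {u v x : V}
include hΦ

theorem edgesConjugateAt_apply (h : EdgesConjugateAt Φ Θ u x) {b : V ≃ₗᵢ[ℝ] V}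
    (hb : b ∈ weyl Θ) : EdgesConjugateAt Φ Θ (b u) (b x) := by
  intro α hα β hβ huα huβ hxα hxβ ⟨c, hc, hcu, hcx⟩
  simp only [inner_apply_left] at huα huβ hxα hxβ
  have hrefl (γ : V) : refl γ (b x) = b (refl (b⁻¹ γ) x) := by
    rw [← refl_apply_apply, apply_inv_apply]
  obtain ⟨d, hd, hdu, hdx, hdα⟩ := h _ (hΦ.apply_mem (inv_mem hb) hα) _
    (hΦ.apply_mem (inv_mem hb) hβ) huα huβ hxα hxβ
    ⟨b⁻¹ * c * b, mul_mem (mul_mem (inv_mem hb) hc) hb,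
      by rw [mul_apply, mul_apply, hcu, inv_apply_apply],
      by rw [mul_apply, mul_apply, ← hrefl, hcx, hrefl, inv_apply_apply]⟩
  refine ⟨b * d * b⁻¹, mul_mem (mul_mem hb hd) (inv_mem hb), ?_, ?_, ?_⟩
  · rw [mul_apply, mul_apply, inv_apply_apply, hdu]
  · rw [mul_apply, mul_apply, inv_apply_apply, hdx]
  · rw [mul_apply, mul_apply, hdα, apply_inv_apply]

theorem edgesConjugateAt_symm (h : EdgesConjugateAt Φ Θ u x) : EdgesConjugateAt Φ Θ x u := by
  intro α hα β hβ hxα hxβ huα huβ ⟨c, hc, hcx, hcu⟩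
  obtain ⟨d, hd, hdu, hdx, hdα⟩ := h α hα β hβ huα huβ hxα hxβ
    ⟨refl β * c * refl α,
      mul_mem (mul_mem (hΦ.refl_mem_weyl β hβ) hc) (hΦ.refl_mem_weyl α hα),
      by rw [mul_apply, mul_apply, hcu, refl_refl],
      by rw [mul_apply, mul_apply, refl_refl, hcx]⟩
  exact ⟨d, hd, hdx, hdu, hdα⟩

theorem edgesConjugate_symm (h : EdgesConjugate Φ Θ u v) : EdgesConjugate Φ Θ v u := by
  intro w hw
  have := hΦ.edgesConjugateAt_apply (h _ (inv_mem hw)) hw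
  rw [apply_inv_apply] at this
  exact hΦ.edgesConjugateAt_symm this

section

variable (hP : ΘP ⊆ Θ) (hQ : ΘQ ⊆ Θ) (hv : IsWeight Θ ΘP v) (hu : IsWeight Θ ΘQ u)
  {𝒟 : DoubleMomentGraph Φ Θ ΘQ ΘP}
include hP hQ hv hu

theorem exists_apply_label_eq_of_isClosed (h : 𝒟.IsClosed) {x : V ≃ₗᵢ[ℝ] V}
    (hx : x ∈ doubleReps Θ ΘQ ΘP) {β : V} (hβ : β ∈ Φ) (hxβ : 0 < ⟪x v, β⟫) (huβ : 0 < ⟪u, β⟫) :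
    ∃ c ∈ weyl ΘQ, c (x v) = x v ∧ c (𝒟.label x (hat Θ ΘQ ΘP (refl β * x))) = β := by
  have hβpos := hΦ.mem_posRoots_of_inner_pos hu hβ huβ
  have hsx := hΦ.refl_mul_mem hβpos hx.1
  have hxP := doubleReps_subset_leftReps hx
  have hedge : 𝒟.closure.edge x (bar Θ ΘP (refl β * x)) β := by
    rw [h]
    exact (hΦ.parabolicGraph_edge_iff hP hv).2 ⟨hxP, bar_mem hP hsx, hβpos, hxβ, bar_apply hv _⟩
  obtain ⟨-, hc⟩ | ⟨a, b, α, hab, c, hc, hxa, hxb, rfl⟩ :=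
    (hΦ.closure_edge_iff hP hQ hv hu 𝒟).1 hedge
  · rw [bar_apply hv, mul_apply, hΦ.exists_mem_weyl_apply_eq_refl_iff hQ hu hβ hxβ.ne'] at hc
    exact absurd hc huβ.ne'
  · obtain ⟨ha, hα, -, -, rfl, hlabel⟩ := (hΦ.toSubgraph_edge_iff hP hQ hv hu 𝒟).1 hab
    have hca : c (a v) = x v := by rw [hxa, bar_apply hv, mul_apply]
    obtain rfl := hΦ.doubleReps_eq_of_apply_eq hP hQ hv ha hx hc hca
    refine ⟨c, hc, hca, ?_⟩
    have hsa := mul_mem (hΦ.refl_mem_weyl α hα) ha.1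
    rw [← (hΦ.hat_eq_iff hP hQ hv hsa hsx).2 ⟨c, hc, ?_⟩, ← hlabel]
    rw [mul_apply, mul_apply, ← refl_apply_apply, hca]

theorem isClosed_of_forall_exists_apply_label_eq
    (h : ∀ x ∈ doubleReps Θ ΘQ ΘP, ∀ β ∈ Φ, 0 < ⟪x v, β⟫ → 0 < ⟪u, β⟫ →
      ∃ c ∈ weyl ΘQ, c (x v) = x v ∧ c (𝒟.label x (hat Θ ΘQ ΘP (refl β * x))) = β) :
    𝒟.IsClosed := by
  refine LabelledGraph.ext (hΦ.closure_verts hP hQ hv 𝒟) ?_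
  ext x y β
  rw [hΦ.closure_edge_iff hP hQ hv hu]
  refine ⟨?_, fun hedge => ?_⟩
  · rintro (⟨hedge, -⟩ | ⟨a, b, α, hab, c, hc, rfl, rfl, rfl⟩)
    · exact hedge
    · exact hΦ.parabolicGraph_edge_of_toSubgraph_edge hP hQ hv hu 𝒟 hab hc
  obtain ⟨hx, hy, hβ, hxβ, hyv⟩ := (hΦ.parabolicGraph_edge_iff hP hv).1 hedge
  by_cases huβ : ⟪u, β⟫ = 0
  · left
    rw [hyv]
    exact ⟨hedge, (hΦ.exists_mem_weyl_apply_eq_refl_iff hQ hu hβ.1 hxβ.ne').2 huβ⟩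
  right
  obtain ⟨d, hd, hdx⟩ := exists_apply_hat_eq (ΘQ := ΘQ) hv x
  have hdΘ := weyl_mono hQ hd
  have hx' := hat_mem (ΘP := ΘP) hP hQ hx.1
  have hβ' : d⁻¹ β ∈ Φ := hΦ.apply_mem (inv_mem hdΘ) hβ.1
  have hxβ' : 0 < ⟪hat Θ ΘQ ΘP x v, d⁻¹ β⟫ := by rwa [← inner_apply_left, hdx]
  have huβ' : 0 < ⟪u, d⁻¹ β⟫ := by
    rw [← inner_apply_left, hu.apply_eq_self hd]
    exact (hu.inner_posRoot_nonneg hβ).lt_of_ne' huβ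
  obtain ⟨c, hc, hcx, hcβ⟩ := h _ hx' _ hβ' hxβ' huβ'
  obtain ⟨hsub, hα, -⟩ := hΦ.label_hat_spec hP hQ hv hu 𝒟 hx' hβ' hxβ' huβ' rfl
  have hdc := mul_mem hd hc
  refine ⟨_, _, _, hsub, d * c, hdc, ?_, ?_, ?_⟩
  · refine hΦ.eq_bar_mul_hat hP hQ hv hx hdc ?_
    rw [mul_apply, hcx, hdx]
  · refine (hΦ.eq_bar_iff hP hv hy (mul_mem (weyl_mono hQ hdc)
      (bar_mem hP (mul_mem (hΦ.refl_mem_weyl _ hα) hx'.1)).1)).2 ?_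
    rw [mul_apply, mul_apply, bar_apply hv, mul_apply, ← refl_apply_apply c, hcβ, hcx,
      ← refl_apply_apply d, apply_inv_apply, hdx, hyv]
  · rw [mul_apply, hcβ, apply_inv_apply]

/-- Two edges from `x` with the same end in `W_Q \ W / W_P` share one label, which conjugates one to
the other. -/
theorem edgesConjugate_of_isClosed (h : 𝒟.IsClosed) : EdgesConjugate Φ Θ u v := by
  suffices hx : ∀ x ∈ doubleReps Θ ΘQ ΘP, EdgesConjugateAt Φ Θ u (x v) by
    intro w hw
    obtain ⟨b, hb, hbw⟩ := exists_apply_hat_eq (ΘQ := ΘQ) hv w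
    have hat_conj := hΦ.edgesConjugateAt_apply (hx _ (hat_mem hP hQ hw)) (weyl_mono hQ hb)
    rwa [hu.apply_eq_self hb, hbw] at hat_conj
  intro x hx α hα β hβ huα huβ hxα hxβ ⟨c, hc, hcu, hcx⟩
  have hhat := (hΦ.hat_eq_iff hP hQ hv (mul_mem (hΦ.refl_mem_weyl α hα) hx.1)
    (mul_mem (hΦ.refl_mem_weyl β hβ) hx.1)).2 ⟨c, (hΦ.mem_weyl_iff hQ hu).2 ⟨hc, hcu⟩, hcx⟩
  obtain ⟨a, ha, hax, haα⟩ :=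
    hΦ.exists_apply_label_eq_of_isClosed hP hQ hv hu h hx hα hxα huα
  obtain ⟨b, hb, hbx, hbβ⟩ :=
    hΦ.exists_apply_label_eq_of_isClosed hP hQ hv hu h hx hβ hxβ huβ
  have hba := mul_mem hb (inv_mem ha)
  refine ⟨b * a⁻¹, weyl_mono hQ hba, hu.apply_eq_self hba, ?_, ?_⟩
  · rw [mul_apply, inv_apply_eq_iff.2 hax.symm, hbx]
  · rw [mul_apply, inv_apply_eq_iff.2 haα.symm, hhat, hbβ]

theorem isClosed_of_edgesConjugate (h : EdgesConjugate Φ Θ u v) : 𝒟.IsClosed := by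
  refine hΦ.isClosed_of_forall_exists_apply_label_eq hP hQ hv hu fun x hx β hβ hxβ huβ => ?_
  obtain ⟨-, hα, hxα, huα, hhat⟩ := hΦ.label_hat_spec hP hQ hv hu 𝒟 hx hβ hxβ huβ rfl
  obtain ⟨c, hc, hcx⟩ := (hΦ.hat_eq_iff hP hQ hv (mul_mem (hΦ.refl_mem_weyl _ hα) hx.1)
    (mul_mem (hΦ.refl_mem_weyl β hβ) hx.1)).1 hhat
  obtain ⟨d, hd, hdu, hdx, hdβ⟩ := h x hx.1 _ hα β hβ huα huβ hxα hxβ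
    ⟨c, weyl_mono hQ hc, hu.apply_eq_self hc, hcx⟩
  exact ⟨d, (hΦ.mem_weyl_iff hQ hu).2 ⟨hd, hdu⟩, hdx, hdβ⟩

theorem isClosed_iff_edgesConjugate : 𝒟.IsClosed ↔ EdgesConjugate Φ Θ u v :=
  ⟨hΦ.edgesConjugate_of_isClosed hP hQ hv hu, hΦ.isClosed_of_edgesConjugate hP hQ hv hu⟩

end

end IsRootBase

end General

namespace TypeB

variable {n : ℕ}

/-! ### Short roots -/

open Classical in
/-- The short roots `± e_i`. The Weyl group permutes them, and its action on vectors is studied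
through the inner products with them. -/
noncomputable def shortRoots (n : ℕ) : Finset (EuclideanSpace ℝ (Fin n)) :=
  Finset.univ.image e ∪ Finset.univ.image fun i => -e i

/-- The root whose reflection interchanges the distinct short roots `ε` and `ε'`: it is `ε - ε'` if
they are orthogonal and `ε` if `ε' = -ε`. -/
noncomputable def swapRoot (ε ε' : EuclideanSpace ℝ (Fin n)) : EuclideanSpace ℝ (Fin n) :=
  (1 - ⟪ε, ε'⟫)⁻¹ • (ε - ε')

variable {ε ε' δ δ' η α β u v x : EuclideanSpace ℝ (Fin n)}

theorem inner_e (v : EuclideanSpace ℝ (Fin n)) (i : Fin n) : ⟪v, e i⟫ = v i := by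
  simp [e, EuclideanSpace.inner_single_right]

theorem norm_e (i : Fin n) : ‖(e i : EuclideanSpace ℝ (Fin n))‖ = 1 := by
  simp [e]

theorem inner_e_e_of_ne {i j : Fin n} (h : i ≠ j) :
    ⟪(e i : EuclideanSpace ℝ (Fin n)), e j⟫ = 0 := by
  rw [inner_e, e]
  simp [h.symm]

theorem mem_shortRoots : ε ∈ shortRoots n ↔ ∃ i, ε = e i ∨ ε = -e i := by
  simp only [shortRoots, Finset.mem_union, Finset.mem_image, Finset.mem_univ, true_and, ← exists_or,
    eq_comm]

theorem e_mem_shortRoots (i : Fin n) : e i ∈ shortRoots n := mem_shortRoots.2 ⟨i, Or.inl rfl⟩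

theorem neg_mem_shortRoots (hε : ε ∈ shortRoots n) : -ε ∈ shortRoots n := by
  obtain ⟨i, rfl | rfl⟩ := mem_shortRoots.1 hε
  · exact mem_shortRoots.2 ⟨i, Or.inr rfl⟩
  · rw [neg_neg]
    exact e_mem_shortRoots i

theorem norm_of_mem_shortRoots (hε : ε ∈ shortRoots n) : ‖ε‖ = 1 := by
  obtain ⟨i, rfl | rfl⟩ := mem_shortRoots.1 hε <;> simp [norm_e]

theorem inner_self_of_mem_shortRoots (hε : ε ∈ shortRoots n) : ⟪ε, ε⟫ = 1 := by
  rw [real_inner_self_eq_norm_sq, norm_of_mem_shortRoots hε, one_pow]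

theorem ne_neg_of_mem_shortRoots (hε : ε ∈ shortRoots n) : ε ≠ -ε := by
  intro h
  have hinner := inner_self_of_mem_shortRoots hε
  nth_rw 2 [h] at hinner
  rw [inner_neg_right, inner_self_of_mem_shortRoots hε] at hinner
  norm_num at hinner

theorem inner_eq_zero_or_eq_or_eq_neg (hε : ε ∈ shortRoots n) (hδ : δ ∈ shortRoots n) :
    ⟪ε, δ⟫ = 0 ∨ δ = ε ∨ δ = -ε := by
  obtain ⟨i, hi⟩ := mem_shortRoots.1 hε
  obtain ⟨j, hj⟩ := mem_shortRoots.1 hδ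
  obtain rfl | hij := eq_or_ne i j
  · rcases hi with rfl | rfl <;> rcases hj with rfl | rfl <;> simp
  · rcases hi with rfl | rfl <;> rcases hj with rfl | rfl <;> simp [inner_e_e_of_ne hij]

theorem inner_eq_zero_of_ne (hε : ε ∈ shortRoots n) (hδ : δ ∈ shortRoots n) (hne : δ ≠ ε)
    (hne' : δ ≠ -ε) : ⟪ε, δ⟫ = 0 := by
  simpa only [hne, hne', or_false] using inner_eq_zero_or_eq_or_eq_neg hε hδ

theorem inner_eq_zero_or_eq_neg (hε : ε ∈ shortRoots n) (hδ : δ ∈ shortRoots n) (hne : ε ≠ δ) :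
    ⟪ε, δ⟫ = 0 ∨ δ = -ε := by
  simpa only [hne.symm, false_or] using inner_eq_zero_or_eq_or_eq_neg hε hδ

theorem one_sub_inner_pos (hε : ε ∈ shortRoots n) (hε' : ε' ∈ shortRoots n) (hne : ε ≠ ε') :
    0 < 1 - ⟪ε, ε'⟫ := by
  obtain h | rfl := inner_eq_zero_or_eq_neg hε hε' hne
  · simp [h]
  · rw [inner_neg_right, inner_self_of_mem_shortRoots hε]
    norm_num

theorem swapRoot_of_inner_eq_zero (h : ⟪ε, ε'⟫ = 0) : swapRoot ε ε' = ε - ε' := by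
  simp [swapRoot, h]

theorem swapRoot_neg_right (hε : ε ∈ shortRoots n) : swapRoot ε (-ε) = ε := by
  rw [swapRoot, inner_neg_right, inner_self_of_mem_shortRoots hε, sub_neg_eq_add ε, ← two_smul ℝ,
    smul_smul]
  norm_num

theorem swapRoot_neg_neg : swapRoot (-ε') (-ε) = swapRoot ε ε' := by
  rw [swapRoot, swapRoot, inner_neg_neg, real_inner_comm, neg_sub_neg]

theorem apply_swapRoot (w : EuclideanSpace ℝ (Fin n) ≃ₗᵢ[ℝ] EuclideanSpace ℝ (Fin n)) :
    w (swapRoot ε ε') = swapRoot (w ε) (w ε') := by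
  rw [swapRoot, swapRoot, map_smul, map_sub, w.inner_map_map]

theorem mem_roots_iff :
    α ∈ roots n ↔ ∃ ε ∈ shortRoots n, ∃ ε' ∈ shortRoots n, ε ≠ ε' ∧ α = swapRoot ε ε' := by
  have he := @e_mem_shortRoots n
  have hne (i) := neg_mem_shortRoots (he i)
  constructor
  · have hsub {ε ε'} (hε : ε ∈ shortRoots n) (hε' : ε' ∈ shortRoots n) (h : ⟪ε, ε'⟫ = 0) :
        ∃ δ ∈ shortRoots n, ∃ δ' ∈ shortRoots n, δ ≠ δ' ∧ ε - ε' = swapRoot δ δ' := by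
      refine ⟨ε, hε, ε', hε', ?_, (swapRoot_of_inner_eq_zero h).symm⟩
      rintro rfl
      rw [inner_self_of_mem_shortRoots hε] at h
      exact one_ne_zero h
    rintro (⟨i, j, hij, rfl | rfl | rfl | rfl⟩ | ⟨i, h⟩)
    · simpa only [sub_neg_eq_add] using hsub (he i) (hne j) (by simp [inner_e_e_of_ne hij])
    · simpa only [neg_add'] using hsub (hne i) (he j) (by simp [inner_e_e_of_ne hij])
    · exact hsub (he i) (he j) (by simp [inner_e_e_of_ne hij])
    · simpa only [neg_sub] using hsub (he j) (he i) (by simp [inner_e_e_of_ne hij.symm])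
    · have hα := mem_shortRoots.2 ⟨i, h⟩
      exact ⟨α, hα, -α, neg_mem_shortRoots hα, ne_neg_of_mem_shortRoots hα,
        (swapRoot_neg_right hα).symm⟩
  · rintro ⟨ε, hε, ε', hε', hne, rfl⟩
    obtain h | rfl := inner_eq_zero_or_eq_neg hε hε' hne
    · rw [swapRoot_of_inner_eq_zero h]
      obtain ⟨i, hi⟩ := mem_shortRoots.1 hε
      obtain ⟨j, hj⟩ := mem_shortRoots.1 hε'
      have hij : i ≠ j := by
        rintro rfl
        rcases hi with rfl | rfl <;> rcases hj with rfl | rfl <;> simp [norm_e] at h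
      refine Or.inl ⟨i, j, hij, ?_⟩
      rcases hi with rfl | rfl <;> rcases hj with rfl | rfl <;> simp [neg_add_eq_sub]
    · rw [swapRoot_neg_right hε]
      exact Or.inr (mem_shortRoots.1 hε)

theorem mem_roots_of_mem_shortRoots (hε : ε ∈ shortRoots n) : ε ∈ roots n :=
  Or.inr (mem_shortRoots.1 hε)

theorem swapRoot_mem_roots (hε : ε ∈ shortRoots n) (hε' : ε' ∈ shortRoots n) (hne : ε ≠ ε') :
    swapRoot ε ε' ∈ roots n :=
  mem_roots_iff.2 ⟨ε, hε, ε', hε', hne, rfl⟩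

theorem norm_sq_swapRoot (hε : ε ∈ shortRoots n) (hε' : ε' ∈ shortRoots n) (hne : ε ≠ ε') :
    ‖swapRoot ε ε'‖ ^ 2 = 2 * (1 - ⟪ε, ε'⟫)⁻¹ := by
  have ht := (one_sub_inner_pos hε hε' hne).ne'
  rw [swapRoot, norm_smul, mul_pow, norm_sub_sq_real, norm_of_mem_shortRoots hε,
    norm_of_mem_shortRoots hε', norm_inv, Real.norm_eq_abs, inv_pow, sq_abs]
  field_simp
  ring

theorem refl_sub_apply_left (h : ‖ε‖ = ‖ε'‖) : refl (ε - ε') ε = ε' :=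
  Submodule.reflection_sub h

theorem refl_sub_apply_right (h : ‖ε‖ = ‖ε'‖) : refl (ε - ε') ε' = ε := by
  rw [← refl_neg, neg_sub, refl_sub_apply_left h.symm]

section SwapRoot

variable (hε : ε ∈ shortRoots n) (hε' : ε' ∈ shortRoots n) (hne : ε ≠ ε')
include hε hε' hne

theorem refl_swapRoot : refl (swapRoot ε ε') = refl (ε - ε') := by
  have hunit : IsUnit (1 - ⟪ε, ε'⟫)⁻¹ := (inv_pos.2 (one_sub_inner_pos hε hε' hne)).ne'.isUnit
  simp only [refl, swapRoot, Submodule.span_singleton_smul_eq hunit]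

theorem refl_swapRoot_apply_left : refl (swapRoot ε ε') ε = ε' := by
  rw [refl_swapRoot hε hε' hne, refl_sub_apply_left]
  rw [norm_of_mem_shortRoots hε, norm_of_mem_shortRoots hε']

theorem refl_swapRoot_apply_right : refl (swapRoot ε ε') ε' = ε := by
  rw [refl_swapRoot hε hε' hne, refl_sub_apply_right]
  rw [norm_of_mem_shortRoots hε, norm_of_mem_shortRoots hε']

theorem inner_swapRoot_pos_iff : 0 < ⟪x, swapRoot ε ε'⟫ ↔ ⟪x, ε'⟫ < ⟪x, ε⟫ := by
  rw [swapRoot, inner_smul_right, mul_pos_iff_of_pos_left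
    (inv_pos.2 (one_sub_inner_pos hε hε' hne)), inner_sub_right, sub_pos]

theorem refl_swapRoot_apply_ne_self_iff (hη : η ∈ shortRoots n) :
    refl (swapRoot ε ε') η ≠ η ↔ η = ε ∨ η = -ε ∨ η = ε' ∨ η = -ε' := by
  have hleft := refl_swapRoot_apply_left hε hε' hne
  have hright := refl_swapRoot_apply_right hε hε' hne
  constructor
  · contrapose!
    rintro ⟨h₁, h₂, h₃, h₄⟩
    rw [refl_swapRoot hε hε' hne, refl_apply_eq_self_iff, inner_sub_right, real_inner_comm,
      real_inner_comm ε', inner_eq_zero_of_ne hε hη h₁ h₂, inner_eq_zero_of_ne hε' hη h₃ h₄,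
      sub_zero]
  · rintro (rfl | rfl | rfl | rfl)
    · rwa [hleft, ne_comm]
    · rwa [map_neg, hleft, Ne, neg_inj, eq_comm]
    · rwa [hright]
    · rwa [map_neg, hright, Ne, neg_inj]

end SwapRoot

theorem refl_apply_mem_shortRoots (hα : α ∈ roots n) (hη : η ∈ shortRoots n) :
    refl α η ∈ shortRoots n := by
  obtain ⟨ε, hε, ε', hε', hne, rfl⟩ := mem_roots_iff.1 hα
  have hleft := refl_swapRoot_apply_left hε hε' hne
  have hright := refl_swapRoot_apply_right hε hε' hne
  by_cases hη' : refl (swapRoot ε ε') η = η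
  · rwa [hη']
  · obtain rfl | rfl | rfl | rfl := (refl_swapRoot_apply_ne_self_iff hε hε' hne hη).1 hη'
    · rwa [hleft]
    · rw [map_neg, hleft]
      exact neg_mem_shortRoots hε'
    · rwa [hright]
    · rw [map_neg, hright]
      exact neg_mem_shortRoots hε

/-! ### The simple roots form a base -/

theorem simpleRoot_of_isMax {i : Fin n} (h : IsMax i) : simpleRoot i = e i :=
  dif_neg fun hi => h.not_lt (b := ⟨i + 1, hi⟩) (Nat.lt_succ_self i)

theorem simpleRoot_of_covBy {i j : Fin n} (h : i ⋖ j) : simpleRoot i = e i - e j := by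
  have hj : (i : ℕ) + 1 = j := Nat.covBy_iff_add_one_eq.1 (Fin.covBy_iff.1 h)
  rw [simpleRoot, dif_pos (hj ▸ j.isLt)]
  congr 2
  exact Fin.ext hj

theorem simpleRoot_mem (i : Fin n) : simpleRoot i ∈ simpleRoots n := Set.mem_range_self i

theorem e_sub_e_mem_closure {i j : Fin n} (h : i ≤ j) :
    (e i - e j : EuclideanSpace ℝ (Fin n)) ∈ AddSubmonoid.closure (simpleRoots n) := by
  induction i using WellFoundedGT.induction with
  | ind i ih =>
    obtain rfl | hij := h.eq_or_lt
    · rw [sub_self]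
      exact zero_mem _
    · obtain ⟨k, hik, hkj⟩ := hij.exists_covby_le
      rw [← sub_add_sub_cancel (e i) (e k), ← simpleRoot_of_covBy hik]
      exact add_mem (AddSubmonoid.subset_closure (simpleRoot_mem i)) (ih k hik.lt hkj)

theorem e_mem_closure (i : Fin n) :
    e i ∈ AddSubmonoid.closure (simpleRoot '' Set.Ici i) := by
  induction i using WellFoundedGT.induction with
  | ind i ih =>
    have hi : simpleRoot i ∈ AddSubmonoid.closure (simpleRoot '' Set.Ici i) :=
      AddSubmonoid.subset_closure ⟨i, Set.self_mem_Ici, rfl⟩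
    by_cases hmax : IsMax i
    · rwa [simpleRoot_of_isMax hmax] at hi
    · obtain ⟨k, hik⟩ := exists_covBy_of_wellFoundedLT hmax
      rw [← sub_add_cancel (e i) (e k), ← simpleRoot_of_covBy hik]
      exact add_mem hi (AddSubmonoid.closure_mono
        (Set.image_mono (Set.Ici_subset_Ici.2 hik.le)) (ih k hik.lt))

theorem e_mem_posRoots (i : Fin n) : e i ∈ posRoots (roots n) (simpleRoots n) :=
  ⟨mem_roots_of_mem_shortRoots (e_mem_shortRoots i),
    AddSubmonoid.closure_mono (Set.image_subset_range _ _) (e_mem_closure i)⟩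

theorem e_sub_e_mem_posRoots {i j : Fin n} (h : i < j) :
    e i - e j ∈ posRoots (roots n) (simpleRoots n) :=
  ⟨Or.inl ⟨i, j, h.ne, by simp⟩, e_sub_e_mem_closure h.le⟩

theorem e_add_e_mem_posRoots {i j : Fin n} (h : i ≠ j) :
    e i + e j ∈ posRoots (roots n) (simpleRoots n) :=
  ⟨Or.inl ⟨i, j, h, by simp⟩, add_mem (e_mem_posRoots i).2 (e_mem_posRoots j).2⟩

theorem simpleRoot_mem_roots (i : Fin n) : simpleRoot i ∈ roots n := by
  by_cases hi : IsMax i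
  · rw [simpleRoot_of_isMax hi]
    exact (e_mem_posRoots i).1
  · obtain ⟨j, hij⟩ := exists_covBy_of_wellFoundedLT hi
    rw [simpleRoot_of_covBy hij]
    exact (e_sub_e_mem_posRoots hij.lt).1

theorem pos_or_neg (hα : α ∈ roots n) :
    α ∈ posRoots (roots n) (simpleRoots n) ∨ -α ∈ posRoots (roots n) (simpleRoots n) := by
  have hsub {i j : Fin n} (hij : i ≠ j) : e i - e j ∈ posRoots (roots n) (simpleRoots n) ∨
      -(e i - e j) ∈ posRoots (roots n) (simpleRoots n) := by
    rw [neg_sub]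
    exact hij.lt_or_gt.imp e_sub_e_mem_posRoots e_sub_e_mem_posRoots
  rcases hα with (⟨i, j, hij, rfl | rfl | rfl | rfl⟩ | ⟨i, rfl | rfl⟩)
  · exact Or.inl (e_add_e_mem_posRoots hij)
  · exact Or.inr (by rw [neg_neg]; exact e_add_e_mem_posRoots hij)
  · exact hsub hij
  · simpa only [neg_sub] using hsub hij.symm
  · exact Or.inl (e_mem_posRoots i)
  · exact Or.inr (by rw [neg_neg]; exact e_mem_posRoots i)

theorem refl_apply_mem_weyl {S : Set (EuclideanSpace ℝ (Fin n))} (hα : refl α ∈ weyl S)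
    (hβ : refl β ∈ weyl S) : refl (refl α β) ∈ weyl S := by
  rw [refl_map]
  exact mul_mem (mul_mem hα hβ) (inv_mem hα)

theorem refl_e_sub_e_mem_weyl (i j : Fin n) : refl (e i - e j) ∈ weyl (simpleRoots n) := by
  wlog hij : i < j generalizing i j
  · obtain rfl | hji := (not_lt.1 hij).eq_or_lt
    · rw [sub_self, refl_zero]
      exact one_mem _
    · rw [← neg_sub, refl_neg]
      exact this j i hji
  induction i using WellFoundedGT.induction with
  | ind i ih =>
    obtain ⟨k, hik, hkj⟩ := hij.exists_covby_le
    have hsimple := refl_mem_weyl_of_mem (simpleRoot_mem i)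
    rw [simpleRoot_of_covBy hik] at hsimple
    obtain rfl | hkj := hkj.eq_or_lt
    · exact hsimple
    · have hmap : refl (e i - e k) (e k - e j) = e i - e j := by
        rw [map_sub, refl_sub_apply_right (by simp only [norm_e]), refl_apply_eq_self_iff.2]
        rw [inner_sub_right, inner_e_e_of_ne hij.ne', inner_e_e_of_ne hkj.ne', sub_zero]
      rw [← hmap]
      exact refl_apply_mem_weyl hsimple (ih k hik.lt hkj)

theorem refl_e_mem_weyl (i : Fin n) : refl (e i) ∈ weyl (simpleRoots n) := by
  have : NeZero n := ⟨i.pos.ne'⟩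
  have hlast := refl_mem_weyl_of_mem (simpleRoot_mem (⊤ : Fin n))
  rw [simpleRoot_of_isMax isMax_top] at hlast
  rw [← refl_sub_apply_right (ε := e i) (ε' := e ⊤) (by simp only [norm_e])]
  exact refl_apply_mem_weyl (refl_e_sub_e_mem_weyl i ⊤) hlast

theorem refl_mem_weyl (hα : α ∈ roots n) : refl α ∈ weyl (simpleRoots n) := by
  have hadd {i j : Fin n} (hij : i ≠ j) : refl (e i + e j) ∈ weyl (simpleRoots n) := by
    have hmap : refl (e j) (e i - e j) = e i + e j := by
      rw [map_sub, refl_self, refl_apply_eq_self_iff.2 (inner_e_e_of_ne hij), sub_neg_eq_add]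
    rw [← hmap]
    exact refl_apply_mem_weyl (refl_e_mem_weyl j) (refl_e_sub_e_mem_weyl i j)
  rcases hα with (⟨i, j, hij, rfl | rfl | rfl | rfl⟩ | ⟨i, rfl | rfl⟩) <;> try rw [refl_neg]
  · exact hadd hij
  · exact hadd hij
  · exact refl_e_sub_e_mem_weyl i j
  · exact refl_e_sub_e_mem_weyl i j
  · exact refl_e_mem_weyl i
  · exact refl_e_mem_weyl i

theorem eq_one_of_nsmul_mem_roots (hα : α ∈ roots n) {k : ℕ} (hk : k • α ∈ roots n) : k = 1 := by
  have hnorm {β : EuclideanSpace ℝ (Fin n)} (hβ : β ∈ roots n) : ‖β‖ ^ 2 = 1 ∨ ‖β‖ ^ 2 = 2 := by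
    obtain ⟨ε, hε, ε', hε', hne, rfl⟩ := mem_roots_iff.1 hβ
    rw [norm_sq_swapRoot hε hε' hne]
    obtain h | rfl := inner_eq_zero_or_eq_neg hε hε' hne
    · norm_num [h]
    · rw [inner_neg_right, inner_self_of_mem_shortRoots hε]
      norm_num
  have hk' : ‖k • α‖ ^ 2 = (k : ℝ) ^ 2 * ‖α‖ ^ 2 := by
    rw [← Nat.cast_smul_eq_nsmul ℝ, norm_smul, mul_pow, Real.norm_natCast]
  have hle : (k : ℝ) ^ 2 ≤ 2 := by
    rcases hnorm hα with h | h <;> rcases hnorm hk with h' | h' <;> rw [h, h'] at hk' <;> linarith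
  have hne : (k : ℝ) ^ 2 ≠ 0 := by
    intro h0
    rw [h0, zero_mul] at hk'
    rcases hnorm hk with h' | h' <;> rw [h'] at hk' <;> norm_num at hk'
  have hk2 : k ^ 2 ≤ 2 := by exact_mod_cast hle
  have hk0 : k ^ 2 ≠ 0 := by exact_mod_cast hne
  have : k < 2 := by nlinarith
  interval_cases k <;> simp_all

/-- The fundamental coweight `e_0 + ⋯ + e_t`. -/
noncomputable def coweight (t : Fin n) : EuclideanSpace ℝ (Fin n) :=
  ∑ i ∈ Finset.Iic t, e i

theorem inner_coweight_simpleRoot (t i : Fin n) :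
    ⟪coweight t, simpleRoot i⟫ = if t = i then 1 else 0 := by
  have happly (j : Fin n) : ⟪coweight t, e j⟫ = if j ≤ t then 1 else 0 := by
    simp only [coweight, sum_inner, inner_e]
    simp [e]
  by_cases hi : IsMax i
  · rw [simpleRoot_of_isMax hi, happly]
    exact if_congr ⟨hi.eq_of_ge, Eq.ge⟩ rfl rfl
  · obtain ⟨j, hij⟩ := exists_covBy_of_wellFoundedLT hi
    rw [simpleRoot_of_covBy hij, inner_sub_right, happly, happly]
    obtain hti | rfl | hti := lt_trichotomy t i
    · simp [hti.not_ge, (hti.trans hij.lt).not_ge, hti.ne]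
    · simp [hij.lt.not_ge]
    · simp [hti.le, hij.ge_of_gt hti, hti.ne']

theorem simpleRoot_injective : Function.Injective (simpleRoot : Fin n → _) := by
  intro i j hij
  by_contra hne
  have h := inner_coweight_simpleRoot i j
  rw [← hij, inner_coweight_simpleRoot, if_pos rfl, if_neg hne] at h
  exact one_ne_zero h

theorem exists_isWeight {S : Set (EuclideanSpace ℝ (Fin n))} (hS : S ⊆ simpleRoots n) :
    ∃ v, IsWeight (simpleRoots n) S v := by
  classical
  have hinner (i : Fin n) : ⟪∑ t with simpleRoot t ∉ S, coweight t, simpleRoot i⟫ =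
      if simpleRoot i ∈ S then 0 else 1 := by
    simp [sum_inner, inner_coweight_simpleRoot, ite_not]
  refine ⟨∑ t with simpleRoot t ∉ S, coweight t, fun α hα => ?_, ?_⟩
  · obtain ⟨i, rfl⟩ := hS hα
    rw [hinner, if_pos hα]
  · rintro _ ⟨i, rfl⟩ hi
    rw [hinner, if_neg hi]
    exact one_pos

theorem isRootBase (n : ℕ) : IsRootBase (roots n) (simpleRoots n) where
  subset := Set.range_subset_iff.2 simpleRoot_mem_roots
  zero_notMem h := by
    have h0 := eq_one_of_nsmul_mem_roots h (k := 0) (by rwa [zero_smul])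
    exact zero_ne_one h0
  refl_mem α hα β hβ := by
    obtain ⟨ε, hε, ε', hε', hne, rfl⟩ := mem_roots_iff.1 hβ
    rw [apply_swapRoot]
    exact swapRoot_mem_roots (refl_apply_mem_shortRoots hα hε) (refl_apply_mem_shortRoots hα hε')
      ((refl α).injective.ne hne)
  reduced a ha k hk := by
    obtain ⟨i, rfl⟩ := ha
    exact eq_one_of_nsmul_mem_roots (simpleRoot_mem_roots i) hk
  pos_or_neg _ := pos_or_neg
  refl_mem_weyl _ := refl_mem_weyl
  exists_weight _ := exists_isWeight

/-! ### Conjugacy of pairs of short roots -/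

theorem apply_mem_shortRoots {w : EuclideanSpace ℝ (Fin n) ≃ₗᵢ[ℝ] EuclideanSpace ℝ (Fin n)}
    (hw : w ∈ weyl (simpleRoots n)) (hη : η ∈ shortRoots n) : w η ∈ shortRoots n := by
  induction hw using weyl_induction with
  | one => exact hη
  | refl_mul a ha w _ ih =>
    rw [mul_apply]
    exact refl_apply_mem_shortRoots ((isRootBase n).subset ha) ih

theorem refl_sub_mem_weyl (hε : ε ∈ shortRoots n) (hε' : ε' ∈ shortRoots n) :
    refl (ε - ε') ∈ weyl (simpleRoots n) := by
  obtain rfl | hne := eq_or_ne ε ε'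
  · rw [sub_self, refl_zero]
    exact one_mem _
  · rw [← refl_swapRoot hε hε' hne]
    exact refl_mem_weyl (swapRoot_mem_roots hε hε' hne)

theorem exists_mem_weyl_apply_eq (hε : ε ∈ shortRoots n) (hε' : ε' ∈ shortRoots n)
    (hδ : δ ∈ shortRoots n) (hδ' : δ' ∈ shortRoots n) (hgram : ⟪ε, ε'⟫ = ⟪δ, δ'⟫)
    (hu : ⟪u, ε⟫ = ⟪u, δ⟫) (hu' : ⟪u, ε'⟫ = ⟪u, δ'⟫) (hx : ⟪x, ε⟫ = ⟪x, δ⟫)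
    (hx' : ⟪x, ε'⟫ = ⟪x, δ'⟫) :
    ∃ c ∈ weyl (simpleRoots n), c u = u ∧ c x = x ∧ c ε = δ ∧ c ε' = δ' := by
  have hfix {η η' y : EuclideanSpace ℝ (Fin n)} (h : ⟪y, η⟫ = ⟪y, η'⟫) : refl (η - η') y = y := by
    rw [refl_apply_eq_self_iff, inner_sub_right, h, sub_self]
  have hswap {η η' : EuclideanSpace ℝ (Fin n)} (hη : η ∈ shortRoots n) (hη' : η' ∈ shortRoots n) :
      refl (η - η') η = η' :=
    refl_sub_apply_left (by rw [norm_of_mem_shortRoots hη, norm_of_mem_shortRoots hη'])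
  have hmem := refl_sub_mem_weyl hε hδ
  have hη := apply_mem_shortRoots hmem hε'
  have hηδ : refl (refl (ε - δ) ε' - δ') δ = δ := by
    refine hfix (Eq.trans ?_ hgram)
    rw [← (refl (ε - δ)).inner_map_map ε ε', hswap hε hδ]
  have hη_fix {y : EuclideanSpace ℝ (Fin n)} (h : ⟪y, ε⟫ = ⟪y, δ⟫) (h' : ⟪y, ε'⟫ = ⟪y, δ'⟫) :
      refl (refl (ε - δ) ε' - δ') y = y :=
    hfix (by rw [inner_apply_of_apply_eq (hfix h), h'])
  refine ⟨refl (refl (ε - δ) ε' - δ') * refl (ε - δ), mul_mem (refl_sub_mem_weyl hη hδ') hmem,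
    ?_, ?_, ?_, ?_⟩
  · rw [mul_apply, hfix hu, hη_fix hu hu']
  · rw [mul_apply, hfix hx, hη_fix hx hx']
  · rw [mul_apply, hswap hε hδ, hηδ]
  · rw [mul_apply, hswap hη hδ']

/-! ### Recovering a root from the inner products with the short roots -/

/-- `u` is orthogonal to no short root. -/
noncomputable def Nonvanishing (u : EuclideanSpace ℝ (Fin n)) : Prop :=
  ∀ ε ∈ shortRoots n, ⟪u, ε⟫ ≠ 0

/-- The inner product with `u` takes every nonzero value on at most one short root. -/
noncomputable def Separating (u : EuclideanSpace ℝ (Fin n)) : Prop :=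
  ∀ ε ∈ shortRoots n, ∀ ε' ∈ shortRoots n, ⟪u, ε⟫ = ⟪u, ε'⟫ → ⟪u, ε⟫ ≠ 0 → ε = ε'

/-- The values of `u` and `x` on `ε`. The multiset of these pairs over all short roots `ε` is an
invariant of the Weyl group orbit of `(u, x)`. -/
noncomputable def innerPair (u x ε : EuclideanSpace ℝ (Fin n)) : ℝ × ℝ := (⟪u, ε⟫, ⟪x, ε⟫)

open Classical in
/-- The short roots moved by the reflection in `α`: the only ones on which `x` and `s_α x` may have
different values. -/
noncomputable def movedShortRoots (α : EuclideanSpace ℝ (Fin n)) :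
    Finset (EuclideanSpace ℝ (Fin n)) :=
  {η ∈ shortRoots n | refl α η ≠ η}

theorem innerPair_neg : innerPair u x (-ε) = -innerPair u x ε := by
  simp [innerPair]

theorem map_shortRoots {w : EuclideanSpace ℝ (Fin n) ≃ₗᵢ[ℝ] EuclideanSpace ℝ (Fin n)}
    (hw : w ∈ weyl (simpleRoots n)) : (shortRoots n).map w.toEquiv.toEmbedding = shortRoots n := by
  refine Finset.eq_of_subset_of_card_le (fun η hη => ?_) (Finset.card_map _).ge
  obtain ⟨ε, hε, rfl⟩ := Finset.mem_map.1 hη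
  exact apply_mem_shortRoots hw hε

theorem map_innerPair_apply {w : EuclideanSpace ℝ (Fin n) ≃ₗᵢ[ℝ] EuclideanSpace ℝ (Fin n)}
    (hw : w ∈ weyl (simpleRoots n)) :
    (shortRoots n).val.map (innerPair (w u) (w x)) = (shortRoots n).val.map (innerPair u x) := by
  conv_lhs => rw [← map_shortRoots hw, Finset.map_val, Multiset.map_map]
  refine Multiset.map_congr rfl fun ε _ => ?_
  exact Prod.ext (w.inner_map_map u ε) (w.inner_map_map x ε)

theorem map_innerPair_refl_add :
    (shortRoots n).val.map (innerPair u (refl α x)) +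
        (movedShortRoots α).val.map (innerPair u x) =
      (shortRoots n).val.map (innerPair u x) +
        (movedShortRoots α).val.map (innerPair u (refl α x)) := by
  classical
  set fixed := (shortRoots n).val.filter fun η => ¬refl α η ≠ η
  have hsplit (f : EuclideanSpace ℝ (Fin n) → ℝ × ℝ) :
      (shortRoots n).val.map f = (movedShortRoots α).val.map f + fixed.map f := by
    rw [← Multiset.map_add, movedShortRoots, Finset.filter_val, Multiset.filter_add_not]
  have hmap_fixed : fixed.map (innerPair u (refl α x)) = fixed.map (innerPair u x) := by
    refine Multiset.map_congr rfl fun η hη => ?_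
    have hη' := not_not.1 (Multiset.mem_filter.1 hη).2
    rw [innerPair, innerPair, ← (refl α).inner_map_map x η, hη']
  rw [hsplit (innerPair u (refl α x)), hsplit (innerPair u x), hmap_fixed]
  abel

/-- The hypothesis is `A - B = A' - B'`, stated without the truncated subtraction. -/
theorem eq_and_eq_of_add_eq_add_of_disjoint {X : Type*} {A B A' B' : Multiset X}
    (h : A + B' = A' + B) (hAB : Disjoint A B) (hAB' : Disjoint A' B') : A = A' ∧ B = B' := by
  classical
  suffices hcount : ∀ a, A.count a = A'.count a ∧ B.count a = B'.count a from
    ⟨Multiset.ext.2 fun a => (hcount a).1, Multiset.ext.2 fun a => (hcount a).2⟩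
  intro a
  have ha := congrArg (Multiset.count a) h
  rw [Multiset.count_add, Multiset.count_add] at ha
  have hzero {C D : Multiset X} (hCD : Disjoint C D) : C.count a = 0 ∨ D.count a = 0 := by
    simp only [Multiset.count_eq_zero]
    exact or_iff_not_imp_left.2 fun hC =>
      Multiset.disjoint_left.1 hCD (not_not.1 hC)
  rcases hzero hAB with h₁ | h₁ <;> rcases hzero hAB' with h₂ | h₂ <;> omega

theorem eq_or_eq_neg_of_insert_eq {X : Type*} [InvolutiveNeg X] {p q p' q' : X}
    (h : ({p, -p, q, -q} : Set X) = {p', -p', q', -q'}) :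
    ((p = p' ∨ p = -p') ∧ (q = q' ∨ q = -q')) ∨ ((p = q' ∨ p = -q') ∧ (q = p' ∨ q = -p')) := by
  have hp : p ∈ ({p', -p', q', -q'} : Set X) := h ▸ by simp
  have hq : q ∈ ({p', -p', q', -q'} : Set X) := h ▸ by simp
  have hp' : p' ∈ ({p, -p, q, -q} : Set X) := h ▸ by simp
  have hq' : q' ∈ ({p, -p, q, -q} : Set X) := h ▸ by simp
  simp only [Set.mem_insert_iff, Set.mem_singleton_iff] at hp hq hp' hq'
  grind [neg_neg]

theorem eq_or_eq_neg_of_swap {p q p' q' : ℝ × ℝ} (h₁ : q.1 < p.1) (h₂ : q.2 < p.2)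
    (h₁' : q'.1 < p'.1) (h₂' : q'.2 < p'.2)
    (hpq : ({p, -p, q, -q} : Set (ℝ × ℝ)) = {p', -p', q', -q'})
    (hswap : ({(p.1, q.2), -(p.1, q.2), (q.1, p.2), -(q.1, p.2)} : Set (ℝ × ℝ)) =
      {(p'.1, q'.2), -(p'.1, q'.2), (q'.1, p'.2), -(q'.1, p'.2)}) :
    (p = p' ∧ q = q') ∨ (p = -q' ∧ q = -p') := by
  wlog hsigns : (p = p' ∨ p = -p') ∧ (q = q' ∨ q = -q') generalizing p' q'
  · have hperm (r s : ℝ × ℝ) : ({r, -r, s, -s} : Set (ℝ × ℝ)) = {-s, s, -r, r} := by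
      ext
      simp only [Set.mem_insert_iff, Set.mem_singleton_iff]
      tauto
    have hneg := this (p' := -q') (q' := -p') (neg_lt_neg h₁') (neg_lt_neg h₂')
      (by rw [hpq, hperm, neg_neg, neg_neg])
      (by rw [hswap, hperm]; simp only [Prod.fst_neg, Prod.snd_neg, ← Prod.neg_mk, neg_neg])
      (by simpa only [neg_neg, or_comm] using
        (eq_or_eq_neg_of_insert_eq hpq).resolve_left hsigns)
    rwa [neg_neg, neg_neg, or_comm] at hneg
  have hleft : (p.1, q.2) ∈ _ := hswap.le (Set.mem_insert _ _)
  have hright : (q.1, p.2) ∈ _ := hswap.le (by simp)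
  simp only [Set.mem_insert_iff, Set.mem_singleton_iff, Prod.ext_iff, Prod.fst_neg,
    Prod.snd_neg] at hleft hright hsigns ⊢
  clear hpq hswap
  left
  -- Two signs `-` contradict the inequalities; if only one of `p` and `q` has the sign `-`, the
  -- swapped pairs force it to vanish.
  grind

theorem mem_movedShortRoots : η ∈ movedShortRoots α ↔ η ∈ shortRoots n ∧ refl α η ≠ η :=
  Finset.mem_filter

section MovedShortRoots

variable (hε : ε ∈ shortRoots n) (hε' : ε' ∈ shortRoots n) (hne : ε ≠ ε')
include hε hε' hne

theorem coe_movedShortRoots_swapRoot :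
    (movedShortRoots (swapRoot ε ε') : Set (EuclideanSpace ℝ (Fin n))) = {ε, -ε, ε', -ε'} := by
  ext η
  rw [Finset.mem_coe, mem_movedShortRoots]
  simp only [Set.mem_insert_iff, Set.mem_singleton_iff]
  constructor
  · rintro ⟨hη, h⟩
    exact (refl_swapRoot_apply_ne_self_iff hε hε' hne hη).1 h
  · intro h
    have hη : η ∈ shortRoots n := by
      rcases h with rfl | rfl | rfl | rfl
      exacts [hε, neg_mem_shortRoots hε, hε', neg_mem_shortRoots hε']
    exact ⟨hη, (refl_swapRoot_apply_ne_self_iff hε hε' hne hη).2 h⟩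

theorem card_movedShortRoots_swapRoot_le_two_iff :
    (movedShortRoots (swapRoot ε ε')).card ≤ 2 ↔ ε' = -ε := by
  classical
  have hmem {η : EuclideanSpace ℝ (Fin n)} :
      η ∈ movedShortRoots (swapRoot ε ε') ↔ η = ε ∨ η = -ε ∨ η = ε' ∨ η = -ε' := by
    rw [← Finset.mem_coe, coe_movedShortRoots_swapRoot hε hε' hne]
    rfl
  constructor
  · contrapose!
    intro h
    refine Finset.two_lt_card.2
      ⟨ε, ?_, -ε, ?_, ε', ?_, ne_neg_of_mem_shortRoots hε, hne, h.symm⟩ <;>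
      simp [hmem]
  · rintro rfl
    refine (Finset.card_le_card fun η hη => ?_).trans (Finset.card_le_two (a := ε) (b := -ε))
    rw [hmem, neg_neg] at hη
    rw [Finset.mem_insert, Finset.mem_singleton]
    tauto

theorem setOf_mem_map_innerPair :
    {r | r ∈ (movedShortRoots (swapRoot ε ε')).val.map (innerPair u x)} =
      {innerPair u x ε, -innerPair u x ε, innerPair u x ε', -innerPair u x ε'} := by
  have himage : {r | r ∈ (movedShortRoots (swapRoot ε ε')).val.map (innerPair u x)} =
      innerPair u x '' movedShortRoots (swapRoot ε ε') := by
    ext r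
    rw [Set.mem_ofPred_eq, Multiset.mem_map]
    rfl
  rw [himage, coe_movedShortRoots_swapRoot hε hε' hne]
  simp only [Set.image_insert_eq, Set.image_singleton, innerPair_neg]

theorem setOf_mem_map_innerPair_refl :
    {r | r ∈ (movedShortRoots (swapRoot ε ε')).val.map (innerPair u (refl (swapRoot ε ε') x))} =
      {(⟪u, ε⟫, ⟪x, ε'⟫), -(⟪u, ε⟫, ⟪x, ε'⟫), (⟪u, ε'⟫, ⟪x, ε⟫), -(⟪u, ε'⟫, ⟪x, ε⟫)} := by
  rw [setOf_mem_map_innerPair hε hε' hne, innerPair, innerPair, inner_apply_left, inner_apply_left,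
    refl_inv, refl_swapRoot_apply_left hε hε' hne, refl_swapRoot_apply_right hε hε' hne]

end MovedShortRoots

theorem inner_eq_zero_of_nonvanishing_or_separating (h : Nonvanishing u ∨ Separating x)
    (hε : ε ∈ shortRoots n) (hε' : ε' ∈ shortRoots n) (hu : ⟪u, ε⟫ = 0)
    (hx : ⟪x, ε⟫ = -⟪x, ε'⟫) (hx0 : ⟪x, ε⟫ ≠ 0) : ⟪u, ε'⟫ = 0 := by
  obtain h | h := h
  · exact absurd hu (h ε hε)
  · rw [← inner_neg_right] at hx
    rwa [h ε hε (-ε') (neg_mem_shortRoots hε') hx hx0, inner_neg_right, neg_eq_zero] at hu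

theorem disjoint_map_innerPair (hux : Nonvanishing u ∨ Separating x)
    (hxu : Nonvanishing x ∨ Separating u) (hα : α ∈ roots n) (huα : 0 < ⟪u, α⟫)
    (hxα : 0 < ⟪x, α⟫) :
    Disjoint ((movedShortRoots α).val.map (innerPair u x))
      ((movedShortRoots α).val.map (innerPair u (refl α x))) := by
  obtain ⟨ε, hε, ε', hε', hne, rfl⟩ := mem_roots_iff.1 hα
  rw [inner_swapRoot_pos_iff hε hε' hne] at huα hxα
  have h₁ := inner_eq_zero_of_nonvanishing_or_separating hux hε hε'
  have h₂ := inner_eq_zero_of_nonvanishing_or_separating hux hε' hε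
  have h₃ := inner_eq_zero_of_nonvanishing_or_separating hxu hε hε'
  have h₄ := inner_eq_zero_of_nonvanishing_or_separating hxu hε' hε
  refine Multiset.disjoint_left.2 fun {r} hr hr' => ?_
  replace hr : r ∈ {r | r ∈ (movedShortRoots (swapRoot ε ε')).val.map (innerPair u x)} := hr
  replace hr' : r ∈ {r | r ∈ (movedShortRoots (swapRoot ε ε')).val.map
    (innerPair u (refl (swapRoot ε ε') x))} := hr'
  rw [setOf_mem_map_innerPair hε hε' hne] at hr
  rw [setOf_mem_map_innerPair_refl hε hε' hne] at hr'
  simp only [Set.mem_insert_iff, Set.mem_singleton_iff, innerPair, Prod.ext_iff, Prod.fst_neg,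
    Prod.snd_neg] at hr hr'
  clear hux hxu
  generalize ⟪u, ε⟫ = a, ⟪u, ε'⟫ = a', ⟪x, ε⟫ = b, ⟪x, ε'⟫ = b' at *
  rcases hr with hr | hr | hr | hr <;> rcases hr' with hr' | hr' | hr' | hr' <;> grind

theorem map_innerPair_movedShortRoots_eq (hux : Nonvanishing u ∨ Separating x)
    (hxu : Nonvanishing x ∨ Separating u) (hα : α ∈ roots n) (hβ : β ∈ roots n)
    (huα : 0 < ⟪u, α⟫) (huβ : 0 < ⟪u, β⟫) (hxα : 0 < ⟪x, α⟫) (hxβ : 0 < ⟪x, β⟫)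
    {c : EuclideanSpace ℝ (Fin n) ≃ₗᵢ[ℝ] EuclideanSpace ℝ (Fin n)}
    (hc : c ∈ weyl (simpleRoots n)) (hcu : c u = u) (hcx : c (refl α x) = refl β x) :
    (movedShortRoots α).val.map (innerPair u x) = (movedShortRoots β).val.map (innerPair u x) ∧
      (movedShortRoots α).val.map (innerPair u (refl α x)) =
        (movedShortRoots β).val.map (innerPair u (refl β x)) := by
  refine eq_and_eq_of_add_eq_add_of_disjoint ?_ (disjoint_map_innerPair hux hxu hα huα hxα)
    (disjoint_map_innerPair hux hxu hβ huβ hxβ)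
  have hinvariant := map_innerPair_apply (u := u) (x := refl α x) hc
  rw [hcu, hcx] at hinvariant
  have hαadd := map_innerPair_refl_add (u := u) (α := α) (x := x)
  have hβadd := map_innerPair_refl_add (u := u) (α := β) (x := x)
  rw [hinvariant] at hβadd
  refine add_left_cancel (a := (shortRoots n).val.map (innerPair u (refl α x)) +
    (shortRoots n).val.map (innerPair u x)) ?_
  rw [add_add_add_comm, hαadd, ← hβadd]
  abel

theorem edgesConjugateAt (hux : Nonvanishing u ∨ Separating x)
    (hxu : Nonvanishing x ∨ Separating u) :
    EdgesConjugateAt (roots n) (simpleRoots n) u x := by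
  intro α hα β hβ huα huβ hxα hxβ ⟨c, hc, hcu, hcx⟩
  obtain ⟨hmap, hmap_refl⟩ :=
    map_innerPair_movedShortRoots_eq hux hxu hα hβ huα huβ hxα hxβ hc hcu hcx
  obtain ⟨ε, hε, ε', hε', hne, rfl⟩ := mem_roots_iff.1 hα
  obtain ⟨δ, hδ, δ', hδ', hne', rfl⟩ := mem_roots_iff.1 hβ
  have hgram : ⟪ε, ε'⟫ = ⟪δ, δ'⟫ := by
    have hcard := congrArg Multiset.card hmap
    rw [Multiset.card_map, Multiset.card_map] at hcard
    have hneg : ε' = -ε ↔ δ' = -δ := by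
      rw [← card_movedShortRoots_swapRoot_le_two_iff hε hε' hne,
        ← card_movedShortRoots_swapRoot_le_two_iff hδ hδ' hne', Finset.card_def, hcard,
        Finset.card_def]
    by_cases h : ε' = -ε
    · rw [h, hneg.1 h, inner_neg_right, inner_neg_right, inner_self_of_mem_shortRoots hε,
        inner_self_of_mem_shortRoots hδ]
    · rw [(inner_eq_zero_or_eq_neg hε hε' hne).resolve_right h,
        (inner_eq_zero_or_eq_neg hδ hδ' hne').resolve_right (mt hneg.2 h)]
  rw [inner_swapRoot_pos_iff hε hε' hne] at huα hxα
  rw [inner_swapRoot_pos_iff hδ hδ' hne'] at huβ hxβ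
  have hpairs := eq_or_eq_neg_of_swap (p := innerPair u x ε) (q := innerPair u x ε')
    (p' := innerPair u x δ) (q' := innerPair u x δ') huα hxα huβ hxβ
    (by rw [← setOf_mem_map_innerPair hε hε' hne, hmap, setOf_mem_map_innerPair hδ hδ' hne'])
    (by
      have h := setOf_mem_map_innerPair_refl hε hε' hne (u := u) (x := x)
      rw [hmap_refl, setOf_mem_map_innerPair_refl hδ hδ' hne'] at h
      exact h.symm)
  rw [← innerPair_neg, ← innerPair_neg] at hpairs
  simp only [innerPair, Prod.mk.injEq] at hpairs
  obtain ⟨⟨hu, hx⟩, hu', hx'⟩ | ⟨⟨hu, hx⟩, hu', hx'⟩ := hpairs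
  · obtain ⟨d, hd, hdu, hdx, hdε, hdε'⟩ :=
      exists_mem_weyl_apply_eq hε hε' hδ hδ' hgram hu hu' hx hx'
    exact ⟨d, hd, hdu, hdx, by rw [apply_swapRoot, hdε, hdε']⟩
  · obtain ⟨d, hd, hdu, hdx, hdε, hdε'⟩ :=
      exists_mem_weyl_apply_eq hε hε' (neg_mem_shortRoots hδ') (neg_mem_shortRoots hδ)
        (by rw [hgram, inner_neg_neg, real_inner_comm]) hu hu' hx hx'
    exact ⟨d, hd, hdu, hdx, by rw [apply_swapRoot, hdε, hdε', swapRoot_neg_neg]⟩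

/-! ### Conjugacy of edges in type `B` -/

theorem nonvanishing_apply {w : EuclideanSpace ℝ (Fin n) ≃ₗᵢ[ℝ] EuclideanSpace ℝ (Fin n)}
    (hw : w ∈ weyl (simpleRoots n)) (h : Nonvanishing u) : Nonvanishing (w u) := by
  intro ε hε
  rw [inner_apply_left]
  exact h _ (apply_mem_shortRoots (inv_mem hw) hε)

theorem separating_apply {w : EuclideanSpace ℝ (Fin n) ≃ₗᵢ[ℝ] EuclideanSpace ℝ (Fin n)}
    (hw : w ∈ weyl (simpleRoots n)) (h : Separating u) : Separating (w u) := by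
  intro ε hε ε' hε' heq hne
  rw [inner_apply_left, inner_apply_left] at heq
  rw [inner_apply_left] at hne
  have hmem {η} (hη : η ∈ shortRoots n) := apply_mem_shortRoots (inv_mem hw) hη
  exact w⁻¹.injective (h _ (hmem hε) _ (hmem hε') heq hne)

theorem exists_inner_pos (hu : u ≠ 0) : ∃ ε ∈ shortRoots n, 0 < ⟪u, ε⟫ := by
  contrapose! hu
  ext i
  have hneg := hu _ (neg_mem_shortRoots (e_mem_shortRoots i))
  rw [inner_neg_right, neg_nonpos] at hneg
  rw [← inner_e]
  exact le_antisymm (hu _ (e_mem_shortRoots i)) hneg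

theorem exists_inner_eq_pos_of_not_separating (h : ¬Separating v) :
    ∃ δ ∈ shortRoots n, ∃ δ' ∈ shortRoots n, δ ≠ δ' ∧ ⟪v, δ⟫ = ⟪v, δ'⟫ ∧ 0 < ⟪v, δ⟫ := by
  rw [Separating] at h
  push Not at h
  obtain ⟨δ, hδ, δ', hδ', heq, hne0, hne⟩ := h
  obtain hneg | hpos := hne0.lt_or_gt
  · exact ⟨-δ, neg_mem_shortRoots hδ, -δ', neg_mem_shortRoots hδ', neg_injective.ne hne,
      by simpa only [inner_neg_right, neg_inj], by simpa only [inner_neg_right, neg_pos]⟩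
  · exact ⟨δ, hδ, δ', hδ', hne, heq, hpos⟩

theorem refl_apply_refl_apply_eq (hε : ε ∈ shortRoots n) (hε' : ε' ∈ shortRoots n)
    (horth : ⟪ε, ε'⟫ = 0) (hx : ⟪x, ε⟫ = ⟪x, ε'⟫) :
    refl ε' (refl ε x) = refl (ε + ε') x := by
  have hswap : refl (ε - ε') ε' = ε :=
    refl_sub_apply_right (by rw [norm_of_mem_shortRoots hε, norm_of_mem_shortRoots hε'])
  have hfix : refl (ε - ε') x = x := by
    rw [refl_apply_eq_self_iff, inner_sub_right, hx, sub_self]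
  have hadd : refl ε' (ε - ε') = ε + ε' := by
    rw [map_sub, refl_self, refl_apply_eq_self_iff.2 horth, sub_neg_eq_add]
  calc refl ε' (refl ε x)
      = refl ε' (refl (refl (ε - ε') ε') (refl (ε - ε') x)) := by rw [hswap, hfix]
    _ = refl ε' (refl (ε - ε') (refl ε' x)) := by rw [refl_apply_apply]
    _ = refl (refl ε' (ε - ε')) (refl ε' (refl ε' x)) := by rw [refl_apply_apply]
    _ = refl (ε + ε') x := by rw [hadd, refl_refl]

/-- The edges from `x` labelled `ε` and `ε + ε'` have conjugate ends, but only the second root is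
long. -/
theorem not_edgesConjugateAt (hε : ε ∈ shortRoots n) (hε' : ε' ∈ shortRoots n)
    (horth : ⟪ε, ε'⟫ = 0) (hu : 0 < ⟪u, ε⟫) (hu' : ⟪u, ε'⟫ = 0) (hx : 0 < ⟪x, ε⟫)
    (hx' : ⟪x, ε⟫ = ⟪x, ε'⟫) : ¬EdgesConjugateAt (roots n) (simpleRoots n) u x := by
  intro h
  have hsum : ε + ε' ∈ roots n := by
    have horth' : ⟪ε, -ε'⟫ = 0 := by rw [inner_neg_right, horth, neg_zero]
    rw [← sub_neg_eq_add, ← swapRoot_of_inner_eq_zero horth']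
    refine swapRoot_mem_roots hε (neg_mem_shortRoots hε') ?_
    rintro rfl
    rw [inner_neg_right, hu', neg_zero] at hu
    exact hu.false
  obtain ⟨c, -, -, -, hcε⟩ := h ε (mem_roots_of_mem_shortRoots hε) (ε + ε') hsum hu
    (by rwa [inner_add_right, hu', add_zero]) hx
    (by rw [inner_add_right, ← hx']; exact add_pos hx hx)
    ⟨refl ε', refl_mem_weyl (mem_roots_of_mem_shortRoots hε'), refl_apply_eq_self_iff.2 hu',
      refl_apply_refl_apply_eq hε hε' horth hx'⟩
  have hinner := c.inner_map_map ε ε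
  rw [hcε, inner_add_add_self, horth, inner_self_of_mem_shortRoots hε,
    inner_self_of_mem_shortRoots hε', real_inner_comm, horth] at hinner
  norm_num at hinner

theorem nonvanishing_or_separating_of_edgesConjugate (hu : u ≠ 0)
    (h : EdgesConjugate (roots n) (simpleRoots n) u v) : Nonvanishing u ∨ Separating v := by
  by_contra! ⟨hnonvanishing, hseparating⟩
  rw [Nonvanishing] at hnonvanishing
  push Not at hnonvanishing
  obtain ⟨ε', hε', hu'⟩ := hnonvanishing
  obtain ⟨ε, hε, hu⟩ := exists_inner_pos hu
  obtain ⟨δ, hδ, δ', hδ', hne, hv', hv⟩ := exists_inner_eq_pos_of_not_separating hseparating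
  have horth : ⟪ε, ε'⟫ = 0 := by
    refine inner_eq_zero_of_ne hε hε' ?_ ?_
    · rintro rfl
      exact hu.ne' hu'
    · rintro rfl
      rw [inner_neg_right, neg_eq_zero] at hu'
      exact hu.ne' hu'
  have horth' : ⟪δ, δ'⟫ = 0 := by
    refine inner_eq_zero_of_ne hδ hδ' hne.symm ?_
    rintro rfl
    rw [inner_neg_right] at hv'
    linarith
  obtain ⟨w, hw, -, -, rfl, rfl⟩ := exists_mem_weyl_apply_eq (u := 0) (x := 0) hδ hδ' hε hε'
    (horth'.trans horth.symm) (by simp) (by simp) (by simp) (by simp)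
  exact not_edgesConjugateAt hε hε' horth hu hu' (by rwa [w.inner_map_map])
    (by rwa [w.inner_map_map, w.inner_map_map]) (h w hw)

theorem edgesConjugate_iff : EdgesConjugate (roots n) (simpleRoots n) u v ↔
    u = 0 ∨ v = 0 ∨ ((Nonvanishing u ∨ Separating v) ∧ (Nonvanishing v ∨ Separating u)) := by
  constructor
  · intro h
    refine or_iff_not_imp_left.2 fun hu => or_iff_not_imp_left.2 fun hv => ⟨?_, ?_⟩
    · exact nonvanishing_or_separating_of_edgesConjugate hu h
    · exact nonvanishing_or_separating_of_edgesConjugate hv ((isRootBase n).edgesConjugate_symm h)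
  · rintro (rfl | rfl | ⟨huv, hvu⟩) w hw
    · intro α _ β _ huα
      rw [inner_zero_left] at huα
      exact absurd huα (lt_irrefl 0)
    · intro α _ β _ _ _ hxα
      rw [map_zero, inner_zero_left] at hxα
      exact absurd hxα (lt_irrefl 0)
    · exact edgesConjugateAt (huv.imp_right (separating_apply hw))
        (hvu.imp_left (nonvanishing_apply hw))

/-! ### Weights in type `B` -/

section Weights

variable {S : Set (EuclideanSpace ℝ (Fin n))} (hS : S ⊆ simpleRoots n)
  (hv : IsWeight (simpleRoots n) S v)
include hv

theorem inner_e_nonneg (i : Fin n) : 0 ≤ ⟪v, e i⟫ :=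
  hv.inner_posRoot_nonneg (e_mem_posRoots i)

theorem antitone_inner_e : Antitone fun i => ⟪v, e i⟫ := by
  intro i j hij
  have hsub := inner_nonneg_of_mem_closure (fun a ha => hv.inner_nonneg ha)
    (e_sub_e_mem_closure hij)
  rwa [inner_sub_right, sub_nonneg] at hsub

theorem inner_e_eq_zero_of_isUpperSet (h : IsUpperSet {i | simpleRoot i ∈ S}) {i : Fin n}
    (hi : simpleRoot i ∈ S) : ⟪v, e i⟫ = 0 := by
  refine le_antisymm ?_ (inner_e_nonneg hv i)
  rw [← neg_nonneg, ← inner_neg_left]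
  refine inner_nonneg_of_mem_closure ?_ (e_mem_closure i)
  rintro _ ⟨j, hij, rfl⟩
  rw [inner_neg_left, hv.inner_eq_zero _ (h hij hi), neg_zero]

include hS

theorem simpleRoot_mem_iff {i : Fin n} : simpleRoot i ∈ S ↔ ⟪v, simpleRoot i⟫ = 0 := by
  rw [hv.mem_iff hS, and_iff_right (simpleRoot_mem i)]

theorem eq_zero_iff : v = 0 ↔ S = simpleRoots n := by
  constructor
  · rintro rfl
    refine hS.antisymm ?_
    rintro _ ⟨i, rfl⟩
    exact (simpleRoot_mem_iff hS hv).2 (inner_zero_left _)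
  · rintro rfl
    ext i
    rw [← inner_e]
    exact refl_apply_eq_self_iff.1 (hv.apply_eq_self (refl_e_mem_weyl i))

theorem nonvanishing_iff {m : Fin n} (hm : IsMax m) : Nonvanishing v ↔ simpleRoot m ∉ S := by
  rw [simpleRoot_mem_iff hS hv, simpleRoot_of_isMax hm]
  refine ⟨fun h => h _ (e_mem_shortRoots m), fun h ε hε => ?_⟩
  have hpos (i : Fin n) : 0 < ⟪v, e i⟫ :=
    ((inner_e_nonneg hv m).lt_of_ne' h).trans_le (antitone_inner_e hv (hm.isTop i))
  obtain ⟨i, rfl | rfl⟩ := mem_shortRoots.1 hε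
  · exact (hpos i).ne'
  · rw [inner_neg_right, neg_ne_zero]
    exact (hpos i).ne'

theorem isUpperSet_of_separating (h : Separating v) : IsUpperSet {i | simpleRoot i ∈ S} := by
  intro i j hij hi
  have hi0 : ⟪v, e i⟫ = 0 := by
    by_contra hne
    have hi' := hv.inner_eq_zero _ hi
    by_cases hmax : IsMax i
    · rw [simpleRoot_of_isMax hmax] at hi'
      exact hne hi'
    · obtain ⟨k, hik⟩ := exists_covBy_of_wellFoundedLT hmax
      rw [simpleRoot_of_covBy hik, inner_sub_right, sub_eq_zero] at hi'
      have heq := h _ (e_mem_shortRoots i) _ (e_mem_shortRoots k) hi' hne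
      have hinner := inner_e_e_of_ne hik.ne
      rw [← heq, inner_self_of_mem_shortRoots (e_mem_shortRoots i)] at hinner
      exact one_ne_zero hinner
  have hzero {k : Fin n} (hik : i ≤ k) : ⟪v, e k⟫ = 0 :=
    le_antisymm ((antitone_inner_e hv hik).trans_eq hi0) (inner_e_nonneg hv k)
  refine (simpleRoot_mem_iff hS hv).2 ?_
  by_cases hmax : IsMax j
  · rw [simpleRoot_of_isMax hmax, hzero hij]
  · obtain ⟨k, hjk⟩ := exists_covBy_of_wellFoundedLT hmax
    rw [simpleRoot_of_covBy hjk, inner_sub_right, hzero hij, hzero (hij.trans hjk.le), sub_zero]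

theorem separating_of_isUpperSet (h : IsUpperSet {i | simpleRoot i ∈ S}) : Separating v := by
  have hlt {i j : Fin n} (hij : i < j) (heq : ⟪v, e i⟫ = ⟪v, e j⟫) : ⟪v, e i⟫ = 0 := by
    obtain ⟨k, hik, hkj⟩ := hij.exists_covby_le
    refine inner_e_eq_zero_of_isUpperSet hv h ((simpleRoot_mem_iff hS hv).2 ?_)
    rw [simpleRoot_of_covBy hik, inner_sub_right, sub_eq_zero]
    exact le_antisymm (heq.trans_le (antitone_inner_e hv hkj)) (antitone_inner_e hv hik.le)
  have hpos {i j : Fin n} (heq : ⟪v, e i⟫ = ⟪v, e j⟫) (hne : ⟪v, e i⟫ ≠ 0) : i = j := by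
    obtain hij | rfl | hji := lt_trichotomy i j
    · exact absurd (hlt hij heq) hne
    · rfl
    · exact absurd (heq.trans (hlt hji heq.symm)) hne
  have hneg {i j : Fin n} (heq : ⟪v, e i⟫ = -⟪v, e j⟫) : ⟪v, e i⟫ = 0 :=
    le_antisymm (heq.trans_le (neg_nonpos.2 (inner_e_nonneg hv j))) (inner_e_nonneg hv i)
  intro ε hε ε' hε' heq hne
  obtain ⟨i, rfl | rfl⟩ := mem_shortRoots.1 hε <;> obtain ⟨j, rfl | rfl⟩ := mem_shortRoots.1 hε'
  · rw [hpos heq hne]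
  · rw [inner_neg_right] at heq
    exact absurd (hneg heq) hne
  · rw [inner_neg_right] at heq hne
    exact absurd (hneg (neg_eq_iff_eq_neg.1 heq)) (neg_ne_zero.1 hne)
  · rw [inner_neg_right] at heq hne
    rw [inner_neg_right] at heq
    rw [hpos (neg_inj.1 heq) (neg_ne_zero.1 hne)]

theorem separating_iff :
    Separating v ↔ S = ∅ ∨ ∃ p : Fin n, S = {β | ∃ i, p ≤ i ∧ β = simpleRoot i} := by
  refine ⟨fun h => or_iff_not_imp_left.2 fun hne => ?_, fun h => separating_of_isUpperSet hS hv ?_⟩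
  · have hupper := isUpperSet_of_separating hS hv h
    obtain ⟨_, hi⟩ := Set.nonempty_iff_ne_empty.2 hne
    obtain ⟨i, rfl⟩ := hS hi
    obtain ⟨p, hp⟩ := (Set.toFinite {i | simpleRoot i ∈ S}).exists_minimal ⟨i, hi⟩
    refine ⟨p, Set.Subset.antisymm (fun β hβ => ?_) ?_⟩
    · obtain ⟨j, rfl⟩ := hS hβ
      exact ⟨j, le_of_not_gt (hp.not_lt hβ), rfl⟩
    · rintro _ ⟨j, hj, rfl⟩
      exact hupper hj hp.prop
  · rintro i j hij hi
    obtain rfl | ⟨p, rfl⟩ := h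
    · exact hi
    · obtain ⟨k, hpk, hik⟩ := hi
      rw [← simpleRoot_injective hik] at hpk
      exact ⟨j, hpk.trans hij, rfl⟩

end Weights

end TypeB

end DoubleMoment

open DoubleMoment TypeB

theorem mainTheorem6 (n : ℕ) (hn : 2 ≤ n) (ΘP ΘQ : Set (EuclideanSpace ℝ (Fin n)))
    (hP : ΘP ⊆ DoubleMoment.TypeB.simpleRoots n) (hQ : ΘQ ⊆ DoubleMoment.TypeB.simpleRoots n)
    (𝒟 : DoubleMoment.DoubleMomentGraph
      (DoubleMoment.TypeB.roots n) (DoubleMoment.TypeB.simpleRoots n) ΘQ ΘP) :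
    𝒟.IsClosed ↔
      ((∃ p q : Fin n, ΘP = {β | ∃ i, p ≤ i ∧ β = DoubleMoment.TypeB.simpleRoot i} ∧
          ΘQ = {β | ∃ i, q ≤ i ∧ β = DoubleMoment.TypeB.simpleRoot i}) ∨
        (DoubleMoment.TypeB.simpleRoot (⟨n - 1, by omega⟩ : Fin n) ∉ ΘP ∧
          DoubleMoment.TypeB.simpleRoot (⟨n - 1, by omega⟩ : Fin n) ∉ ΘQ) ∨
        (ΘP = DoubleMoment.TypeB.simpleRoots n ∨ ΘQ = DoubleMoment.TypeB.simpleRoots n) ∨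
        (ΘP = ∅ ∨ ΘQ = ∅)) := by
  set m : Fin n := ⟨n - 1, by omega⟩
  have hm : IsMax m := fun j _ => Fin.le_def.2 (Nat.le_sub_one_of_lt j.isLt)
  have hupper {S : Set (EuclideanSpace ℝ (Fin n))} (hS : simpleRoot m ∉ S) :
      ¬∃ p : Fin n, S = {β | ∃ i, p ≤ i ∧ β = simpleRoot i} := by
    rintro ⟨p, rfl⟩
    exact hS ⟨m, hm.isTop p, rfl⟩
  have hempty {S : Set (EuclideanSpace ℝ (Fin n))} (hS : simpleRoot m ∈ S) : S ≠ ∅ :=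
    (Set.nonempty_of_mem hS).ne_empty
  obtain ⟨v, hv⟩ := exists_isWeight hP
  obtain ⟨u, hu⟩ := exists_isWeight hQ
  rw [(isRootBase n).isClosed_iff_edgesConjugate hP hQ hv hu, edgesConjugate_iff,
    eq_zero_iff hQ hu, eq_zero_iff hP hv, nonvanishing_iff hQ hu hm, nonvanishing_iff hP hv hm,
    separating_iff hP hv, separating_iff hQ hu]
  simp only [exists_and_left, exists_and_right]
  by_cases hmP : simpleRoot m ∈ ΘP <;> by_cases hmQ : simpleRoot m ∈ ΘQ
  · simp [hmP, hmQ, hempty hmP, hempty hmQ, or_assoc, or_comm, or_left_comm]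
  · simp [hmP, hmQ, hupper hmQ, hempty hmP, or_assoc, or_comm, or_left_comm]
  · simp [hmP, hmQ, hupper hmP, hempty hmQ, or_assoc, or_comm, or_left_comm]
  · simp [hmP, hmQ, or_comm]
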